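/- Let $0<S<T$. Let $L_S\in\mathbb R^{m_S\times d}$, $L_T\in\mathbb R^{m_T\times d}$, let $\Sigma_S,\Sigma_T$ be covariance (symmetric positive semidefinite) matrices of sizes $m_S$, $m_T$, and let $v_S\in\mathbb R^{m_S}$, $v_T\in\mathbb R^{m_T}$ be the realised values of observations $V_S=L_SX_S+\eta_S$, $V_T=L_TX_T+\eta_T$ with independent noises $\eta_S\sim N(0,\Sigma_S)$, $\eta_T\sim N(0,\Sigma_T)$. Let $\tilde X$ be the linear process $$d\tilde X_t=(\tilde\beta(t)+\tilde B(t)\tilde X_t)\,dt+\tilde\sigma(t)\,dW_t,\qquad t\in[0,T],$$ in $\mathbb R^d$, where $W$ is a $d'$-dimensional standard Brownian motion, $\tilde\beta,\tilde B$ are integrable and $\tilde\sigma$ is square integrable on $[0,T]$. Let $\tilde p(s,x;\tau,d\xi)$, $0\le s\le\tau\le T$, be its transition law, i.e. the law of $\tilde X_\tau$ when $\tilde X_s=x$ (equal to $\tilde p(s,x;\tau,\xi)\,d\xi$ if there is a transition density, and to the point mass at $x$ if $\tau=s$). Let $\phi(y;\Sigma)$ be the $N(0,\Sigma)$ density at $y$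 and define $$\tilde\rho(t,x)=\begin{cases}\displaystyle\int\phi(v_S-L_S\xi_S;\Sigma_S)\Big(\int\phi(v_T-L_T\xi_T;\Sigma_T)\,\tilde p(S,\xi_S;T,d\xi_T)\Big)\tilde p(t,x;S,d\xi_S),& t\in[0,S],\\[2mm]\displaystyle\int\phi(v_T-L_T\xi_T;\Sigma_T)\,\tilde p(t,x;T,d\xi_T),& t\in(S,T].\end{cases}$$ Let $\Phi$ be the continuous solution of $d\Phi(t)=\tilde B(t)\Phi(t)\,dt$, $\Phi(0)=I$, on $[0,T]$; put $\Phi(t,s)=\Phi(t)\Phi(s)^{-1}$ and $\tilde a=\tilde\sigma\tilde\sigma'$. For $t\in(S,T]$ put $$\tilde L(t)=L_T\Phi(T,t),\qquad \Upsilon(t)=\Sigma_T,\qquad x_{\rm obs}(t)=v_T,$$ and for $t\in[0,S]$ $$\tilde L(t)=\begin{bmatrix}L_S\Phi(S,t)\mathbf 1_{[0,S]}(t)\\ L_T\Phi(T,t)\end{bmatrix},\qquad \Upsilon(t)=\begin{bmatrix}\Sigma_S&0\\0&\Sigma_T\end{bmatrix},\qquad x_{\rm obs}(t)=\begin{bmatrix}v_S\\v_T\end{bmatrix}.$$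 Let $\mu(t)=\int_t^T\tilde L(\tau)\tilde\beta(\tau)\,d\tau$, where for $t\in[0,S]$ the two-block form of $\tilde L(\tau)$ (whose first block vanishes for $\tau>S$) is used on all of $[t,T]$, here and in the next formula. Assume that for every $t\in[0,T]$ the inverse $$\tilde M(t)=\Big(\int_t^T\tilde L(\tau)\tilde a(\tau)\tilde L(\tau)'\,d\tau+\Upsilon(t)\Big)^{-1}$$ exists. Then for all $t\in[0,T]$ the function $\tilde\rho(t,\cdot)$ is positive, $\log\tilde\rho(t,\cdot)$ is twice continuously differentiable, and for all $x\in\mathbb R^d$ $$\tilde H(t):=-D^2\log\tilde\rho(t,x)=\tilde L(t)'\tilde M(t)\tilde L(t),$$ $$\tilde r(t,x):=D\log\tilde\rho(t,x)=\tilde L(t)'\tilde M(t)\big(x_{\rm obs}(t)-\mu(t)-\tilde L(t)x\big),$$ where $D$ and $D^2$ are the gradient (a column vector) and the Hessian in $x$; in particular $\tilde H(t)$ does not depend on $x$. -/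

import Mathlib

open MeasureTheory ProbabilityTheory Set Filter Topology Matrix
open scoped NNReal ENNReal

namespace TwoCond

/-! ### Integrals of deterministic functions against Brownian motion -/

/-- A left-continuous real step function `∑ₖ valₖ 1_{(ptₖ, ptₖ₊₁]}`, `k < len`. -/
structure StepFn where
  len : ℕ
  pt : ℕ → ℝ
  val : ℕ → ℝ
  mono : Monotone pt

/-- The step function as a function of time. -/
noncomputable def StepFn.toFun (h : StepFn) (u : ℝ) : ℝ :=
  ∑ k ∈ Finset.range h.len, (Ioc (h.pt k) (h.pt (k + 1))).indicator (fun _ => h.val k) u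

/-- The elementary integral `∑ₖ valₖ (W(ptₖ₊₁) - W(ptₖ))`. -/
noncomputable def StepFn.integral {Ω : Type*} (h : StepFn) (W : ℝ≥0 → Ω → ℝ) (ω : Ω) : ℝ :=
  ∑ k ∈ Finset.range h.len,
    h.val k * (W (h.pt (k + 1)).toNNReal ω - W (h.pt k).toNNReal ω)

/-- `J` is (a version of) the stochastic integral `∫ₛᵗ f dW` of the deterministic function `f`:
the `L²(P)`-limit of the elementary integrals of step functions on `[s,t]` that converge to `f`
in `L²([s,t])`. -/
def IsWienerIntegral {Ω : Type*} [MeasurableSpace Ω] (P : Measure Ω) (W : ℝ≥0 → Ω → ℝ)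
    (f : ℝ → ℝ) (s t : ℝ) (J : Ω → ℝ) : Prop :=
  MemLp J 2 P ∧ ∃ h : ℕ → StepFn,
    (∀ n k, (h n).pt k ∈ Icc s t) ∧
    Tendsto (fun n => eLpNorm (fun u => (h n).toFun u - f u) 2 (volume.restrict (Ioc s t)))
      atTop (𝓝 0) ∧
    Tendsto (fun n => eLpNorm (fun ω => (h n).integral W ω - J ω) 2 P) atTop (𝓝 0)

/-- `W` is a vector of independent standard Brownian motions under `P`. -/
def IsBrownianVector {Ω : Type*} [MeasurableSpace Ω] (P : Measure Ω) {d' : ℕ}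
    (W : Fin d' → ℝ≥0 → Ω → ℝ) : Prop :=
  (∀ j, IsBrownianReal (W j) P) ∧ iIndepFun (fun j ω (t : ℝ≥0) => W j t ω) P

/-! ### The data of the problem -/

/-- The data: state dimension `d`, Brownian dimension `d'`, observation dimensions `mS`, `mT`;
observation times `S`, `T`; observation matrices, noise covariances and observed values at
these times; and the coefficients of the linear equation
`dX = (β(t) + B(t) X) dt + σ(t) dW`. The structure carries no assumption. -/
structure Data (d d' mS mT : ℕ) where
  S : ℝ
  T : ℝ
  LS : Matrix (Fin mS) (Fin d) ℝ
  LT : Matrix (Fin mT) (Fin d) ℝ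
  covS : Matrix (Fin mS) (Fin mS) ℝ
  covT : Matrix (Fin mT) (Fin mT) ℝ
  vS : Fin mS → ℝ
  vT : Fin mT → ℝ
  β : ℝ → Fin d → ℝ
  B : ℝ → Matrix (Fin d) (Fin d) ℝ
  σ : ℝ → Matrix (Fin d) (Fin d') ℝ

variable {d d' mS mT : ℕ}

/-- `0 < S < T`, the noise covariance matrices are symmetric and positive semidefinite, and the
coefficients are such that the linear stochastic differential equation on `[0,T]` makes sense:
`β`, `B` integrable and `σ` square integrable (measurability included). -/
structure Data.IsAdmissible (D : Data d d' mS mT) : Prop where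
  S_pos : 0 < D.S
  S_lt_T : D.S < D.T
  covS_posSemidef : D.covS.PosSemidef
  covT_posSemidef : D.covT.PosSemidef
  integrable_β : ∀ i, IntegrableOn (fun t => D.β t i) (Icc 0 D.T)
  integrable_B : ∀ i j, IntegrableOn (fun t => D.B t i j) (Icc 0 D.T)
  memLp_σ : ∀ i j, MemLp (fun t => D.σ t i j) 2 (volume.restrict (Icc 0 D.T))

/-! ### The linear process and the function whose logarithm is differentiated -/

/-- `X` solves `dX = (β(t) + B(t) X) dt + σ(t) dW` on `[s,T]` with `X_s = x`. -/
structure Data.IsSolution (D : Data d d' mS mT) {Ω : Type*} [MeasurableSpace Ω] (P : Measure Ω)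
    (W : Fin d' → ℝ≥0 → Ω → ℝ) (s : ℝ) (x : Fin d → ℝ) (X : ℝ → Ω → Fin d → ℝ) : Prop where
  measurable : ∀ t ∈ Icc s D.T, Measurable (X t)
  continuousOn : ∀ᵐ ω ∂P, ContinuousOn (fun t => X t ω) (Icc s D.T)
  initial : ∀ᵐ ω ∂P, X s ω = x
  equation : ∀ t ∈ Icc s D.T, ∀ i, ∃ J : Fin d' → Ω → ℝ,
    (∀ j, IsWienerIntegral P (W j) (fun u => D.σ u i j) s t (J j)) ∧
    ∀ᵐ ω ∂P, X t ω i = x i + (∫ u in s..t, (D.β u i + (D.B u *ᵥ X u ω) i)) + ∑ j, J j ω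

/-- The density at `y` of the centred normal distribution with covariance matrix `C`. -/
noncomputable def normalDensity {m : ℕ} (y : Fin m → ℝ) (C : Matrix (Fin m) (Fin m) ℝ) : ℝ :=
  (√((2 * Real.pi) ^ m * C.det))⁻¹ * Real.exp (-(y ⬝ᵥ (C⁻¹ *ᵥ y)) / 2)

/-- `X s x τ` is the state at time `τ` of the process started at time `s` in `x`; its law
`P.map (X s x τ)` is the transition law, written `p(s,x;τ,ξ) dξ` when it has a density, and
equal to the point mass at `x` when `τ = s`. For `t ≤ S` this is
`∫∫ φ(vS - LS ξS; covS) φ(vT - LT ξT; covT) p(S,ξS;T,dξT) p(t,x;S,dξS)`, and for `t > S` it is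
`∫ φ(vT - LT ξT; covT) p(t,x;T,dξT)`. -/
noncomputable def Data.rho (D : Data d d' mS mT) {Ω : Type*} [MeasurableSpace Ω] (P : Measure Ω)
    (X : ℝ → (Fin d → ℝ) → ℝ → Ω → Fin d → ℝ) (t : ℝ) (x : Fin d → ℝ) : ℝ :=
  if t ≤ D.S then
    ∫ ξS, normalDensity (D.vS - D.LS *ᵥ ξS) D.covS *
      (∫ ξT, normalDensity (D.vT - D.LT *ᵥ ξT) D.covT ∂(P.map (X D.S ξS D.T)))
      ∂(P.map (X t x D.S))
  else
    ∫ ξT, normalDensity (D.vT - D.LT *ᵥ ξT) D.covT ∂(P.map (X t x D.T))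

/-- The column vector of the partial derivatives of `f` at `x`. -/
noncomputable def grad (f : (Fin d → ℝ) → ℝ) (x : Fin d → ℝ) : Fin d → ℝ :=
  fun i => fderiv ℝ f x (Pi.single i 1)

/-- The matrix of the second partial derivatives `∂²f / ∂xᵢ∂xⱼ` at `x`. -/
noncomputable def hess (f : (Fin d → ℝ) → ℝ) (x : Fin d → ℝ) : Matrix (Fin d) (Fin d) ℝ :=
  Matrix.of fun i j => fderiv ℝ (fun z => grad f z j) x (Pi.single i 1)

/-- `r(t,x) = D log ρ(t,x)`. -/
noncomputable def Data.r (D : Data d d' mS mT) {Ω : Type*} [MeasurableSpace Ω] (P : Measure Ω)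
    (X : ℝ → (Fin d → ℝ) → ℝ → Ω → Fin d → ℝ) (t : ℝ) (x : Fin d → ℝ) : Fin d → ℝ :=
  grad (fun y => Real.log (D.rho P X t y)) x

/-- `-D² log ρ(t,x)`. -/
noncomputable def Data.H (D : Data d d' mS mT) {Ω : Type*} [MeasurableSpace Ω] (P : Measure Ω)
    (X : ℝ → (Fin d → ℝ) → ℝ → Ω → Fin d → ℝ) (t : ℝ) (x : Fin d → ℝ) :
    Matrix (Fin d) (Fin d) ℝ :=
  -hess (fun y => Real.log (D.rho P X t y)) x

/-! ### The deterministic quantities -/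

/-- `Φ` solves `dΦ(t) = B(t) Φ(t) dt`, `Φ(0) = I`, on `[0,T]`. -/
def Data.IsFundamental (D : Data d d' mS mT) (Φ : ℝ → Matrix (Fin d) (Fin d) ℝ) : Prop :=
  ContinuousOn Φ (Icc 0 D.T) ∧
  ∀ t ∈ Icc 0 D.T, ∀ i j,
    Φ t i j = (1 : Matrix (Fin d) (Fin d) ℝ) i j + ∫ u in (0 : ℝ)..t, (D.B u * Φ u) i j

/-- `Φ(t,s) = Φ(t) Φ(s)⁻¹`. -/
noncomputable def flow (Φ : ℝ → Matrix (Fin d) (Fin d) ℝ) (t s : ℝ) : Matrix (Fin d) (Fin d) ℝ :=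
  Φ t * (Φ s)⁻¹

/-- `a(t) = σ(t) σ(t)'`. -/
noncomputable def Data.a (D : Data d d' mS mT) (t : ℝ) : Matrix (Fin d) (Fin d) ℝ :=
  D.σ t * (D.σ t)ᵀ

/-- Entrywise integral of a matrix valued function. -/
noncomputable def matIntegral {m n : Type*} (F : ℝ → Matrix m n ℝ) (s t : ℝ) : Matrix m n ℝ :=
  Matrix.of fun i j => ∫ τ in s..t, F τ i j

/-- `L(t) = LT Φ(T,t)`, used on `(S,T]`. -/
noncomputable def Data.Llate (D : Data d d' mS mT) (Φ : ℝ → Matrix (Fin d) (Fin d) ℝ) (t : ℝ) :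
    Matrix (Fin mT) (Fin d) ℝ :=
  D.LT * flow Φ D.T t

/-- `L(t)` with block rows `LS Φ(S,t) 1_{[0,S]}(t)` and `LT Φ(T,t)`, used on `[0,S]` and, with its
indicator, inside the integrals over `[t,T]` with `t ∈ [0,S]`. -/
noncomputable def Data.Learly (D : Data d d' mS mT) (Φ : ℝ → Matrix (Fin d) (Fin d) ℝ) (t : ℝ) :
    Matrix (Fin mS ⊕ Fin mT) (Fin d) ℝ :=
  Matrix.fromRows ((Icc 0 D.S).indicator (fun τ => D.LS * flow Φ D.S τ) t) (D.LT * flow Φ D.T t)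

/-- `Υ(t)` on `[0,S]`: the block diagonal covariance matrix of the joint noise. -/
def Data.UpsEarly (D : Data d d' mS mT) : Matrix (Fin mS ⊕ Fin mT) (Fin mS ⊕ Fin mT) ℝ :=
  Matrix.fromBlocks D.covS 0 0 D.covT

/-- `∫ₜᵀ L a L' dτ + Υ(t)` for `t ∈ [0,S]`. -/
noncomputable def Data.MdagEarly (D : Data d d' mS mT) (Φ : ℝ → Matrix (Fin d) (Fin d) ℝ)
    (t : ℝ) : Matrix (Fin mS ⊕ Fin mT) (Fin mS ⊕ Fin mT) ℝ :=
  matIntegral (fun τ => D.Learly Φ τ * D.a τ * (D.Learly Φ τ)ᵀ) t D.T + D.UpsEarly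

/-- `∫ₜᵀ L a L' dτ + Υ(t)` for `t ∈ (S,T]`. -/
noncomputable def Data.MdagLate (D : Data d d' mS mT) (Φ : ℝ → Matrix (Fin d) (Fin d) ℝ)
    (t : ℝ) : Matrix (Fin mT) (Fin mT) ℝ :=
  matIntegral (fun τ => D.Llate Φ τ * D.a τ * (D.Llate Φ τ)ᵀ) t D.T + D.covT

/-- `M(t)` for `t ∈ [0,S]`. -/
noncomputable def Data.Mearly (D : Data d d' mS mT) (Φ : ℝ → Matrix (Fin d) (Fin d) ℝ)
    (t : ℝ) : Matrix (Fin mS ⊕ Fin mT) (Fin mS ⊕ Fin mT) ℝ :=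
  (D.MdagEarly Φ t)⁻¹

/-- `M(t)` for `t ∈ (S,T]`. -/
noncomputable def Data.Mlate (D : Data d d' mS mT) (Φ : ℝ → Matrix (Fin d) (Fin d) ℝ)
    (t : ℝ) : Matrix (Fin mT) (Fin mT) ℝ :=
  (D.MdagLate Φ t)⁻¹

/-- The inverse defining `M(t)` exists for every `t ∈ [0,T]`. -/
def Data.MExists (D : Data d d' mS mT) (Φ : ℝ → Matrix (Fin d) (Fin d) ℝ) : Prop :=
  (∀ t ∈ Icc 0 D.S, IsUnit (D.MdagEarly Φ t)) ∧ ∀ t ∈ Ioc D.S D.T, IsUnit (D.MdagLate Φ t)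

/-- `μ(t) = ∫ₜᵀ L(τ) β(τ) dτ` for `t ∈ [0,S]`. -/
noncomputable def Data.muEarly (D : Data d d' mS mT) (Φ : ℝ → Matrix (Fin d) (Fin d) ℝ)
    (t : ℝ) : Fin mS ⊕ Fin mT → ℝ :=
  fun i => ∫ τ in t..D.T, (D.Learly Φ τ *ᵥ D.β τ) i

/-- `μ(t) = ∫ₜᵀ L(τ) β(τ) dτ` for `t ∈ (S,T]`. -/
noncomputable def Data.muLate (D : Data d d' mS mT) (Φ : ℝ → Matrix (Fin d) (Fin d) ℝ)
    (t : ℝ) : Fin mT → ℝ :=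
  fun i => ∫ τ in t..D.T, (D.Llate Φ τ *ᵥ D.β τ) i

/-- The stacked observed values, `x_obs(t)` for `t ∈ [0,S]`. -/
def Data.obsEarly (D : Data d d' mS mT) : Fin mS ⊕ Fin mT → ℝ :=
  Sum.elim D.vS D.vT

end TwoCond

/-! A linear equation with deterministic coefficients has normal transition laws: started at time
`s` in `x`, the state at time `t` has mean `Φ(t,s)x + ∫ₛᵗ Φ(t,u)β(u) du` and covariance `∫ₛᵗ
Φ(t,u)a(u)Φ(t,u)' du`. Integrating a normal density `φ(v - Lξ; Q)` against `N(m, C)` gives `φ(v -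
Lm; Q + LCL')`. After `S`, one such integration yields `ρ`. Up to `S`, the inner integral is a
normal density in `ξS`; its product with the density of the first observation is one normal density
of the stacked vector, with block diagonal covariance, and a second integration applies. In both
cases `ρ(t,x) = φ(x_obs - μ - Lx; M⁻¹)`, so `log ρ` is a quadratic polynomial in `x` whose
derivatives can be read off.

The transition law may be degenerate, so it enters only through its characteristic function; the
convolution formula `integral_gaussDensity_of_charFun` is Fourier inversion for the density combined
with Fubini.

The characteristic function, `Data.IsSolution.integral_cexp`, is obtained without Itô's formula. Put
`c(u) = θ'Φ(t,u)` and consider the sums of `c(uₖ₊₁)` times the increments over `[uₖ, uₖ₊₁]` of the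
martingale part. Along every continuous path they converge to `θ'Xₜ` minus `θ'` times the mean
(`tendsto_sum_flow_mul_martPart`). In law, each sum is a Wiener integral of a deterministic kernel,
hence centred normal with variance the squared `L²` norm of the kernel
(`integral_cexp_of_mem_wienerPairs`), and these variances tend to `θ'Cθ`. Comparing the two limits
identifies the law.

Nondegeneracy comes from two instants only: invertibility at `T` makes `covT` positive definite and
invertibility at `S` does the same for `covS` (`Data.MExists.posDef_covT`,
`Data.MExists.posDef_covS`); every other covariance adds a positive semidefinite term. -/

namespace TwoCond

/-! ### Normal densities: Fourier inversion and convolution with a normal law -/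

section GaussianDensity

variable {ι κ : Type*} [Fintype ι] [DecidableEq ι] [Fintype κ]

/-- The density at `y` of the centred normal distribution with covariance matrix `C`, for an
arbitrary finite index type. -/
noncomputable def gaussDensity (y : ι → ℝ) (C : Matrix ι ι ℝ) : ℝ :=
  (√((2 * Real.pi) ^ Fintype.card ι * C.det))⁻¹ * Real.exp (-(y ⬝ᵥ (C⁻¹ *ᵥ y)) / 2)

theorem normalDensity_eq_gaussDensity {m : ℕ} (y : Fin m → ℝ) (C : Matrix (Fin m) (Fin m) ℝ) :
    normalDensity y C = gaussDensity y C := by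
  simp [normalDensity, gaussDensity]

theorem gaussDensity_pos {C : Matrix ι ι ℝ} (hC : C.PosDef) (y : ι → ℝ) :
    0 < gaussDensity y C := by
  have := hC.det_pos
  unfold gaussDensity
  positivity

theorem continuous_gaussDensity (C : Matrix ι ι ℝ) : Continuous fun y => gaussDensity y C := by
  unfold gaussDensity
  refine continuous_const.mul (Real.continuous_exp.comp ?_)
  refine (Continuous.neg ?_).div_const _
  exact continuous_id.dotProduct (continuous_const.matrix_mulVec continuous_id)

/-- The positive square root serves as `A`; it is invertible because its determinant squares to `det
C > 0`. The substitution `w = Au` then reduces Gaussian integrals to `C = 1`. -/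
theorem exists_transpose_mul_self_eq {C : Matrix ι ι ℝ} (hC : C.PosDef) :
    ∃ A : Matrix ι ι ℝ, IsUnit A.det ∧ C = Aᵀ * A := by
  open scoped MatrixOrder in
  have h0 : (0 : Matrix ι ι ℝ) ≤ C := Matrix.nonneg_iff_posSemidef.2 hC.posSemidef
  have h1 : CFC.sqrt C * CFC.sqrt C = C := CFC.sqrt_mul_sqrt_self C h0
  have h2 : (CFC.sqrt C).PosSemidef := Matrix.nonneg_iff_posSemidef.1 (CFC.sqrt_nonneg C)
  have h3 : (CFC.sqrt C)ᵀ = CFC.sqrt C := by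
    have := h2.isHermitian
    rwa [Matrix.IsHermitian, conjTranspose_eq_transpose_of_trivial] at this
  refine ⟨CFC.sqrt C, ?_, by rw [h3, h1]⟩
  have h4 : (CFC.sqrt C).det * (CFC.sqrt C).det = C.det := by rw [← det_mul, h1]
  exact isUnit_iff_ne_zero.2 fun h => hC.det_pos.ne' (by rw [← h4, h, zero_mul])

theorem measurableEmbedding_toLin' {A : Matrix ι ι ℝ} (hA : IsUnit A.det) :
    MeasurableEmbedding (Matrix.toLin' A) := by
  let e : (ι → ℝ) ≃L[ℝ] (ι → ℝ) :=
    (LinearEquiv.ofIsUnitDet (f := Matrix.toLin' A) (v := Pi.basisFun ℝ ι) (v' := Pi.basisFun ℝ ι)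
      (by simpa using hA)).toContinuousLinearEquiv
  simpa using! e.toHomeomorph.measurableEmbedding

theorem integral_comp_mulVec {A : Matrix ι ι ℝ} (hA : IsUnit A.det) (f : (ι → ℝ) → ℂ) :
    ∫ u, f (A *ᵥ u) = |A.det|⁻¹ * ∫ u, f u := by
  have h := Real.map_matrix_volume_pi_eq_smul_volume_pi hA.ne_zero
  have he := measurableEmbedding_toLin' hA
  have h2 := he.integral_map (μ := volume) f
  rw [h, integral_smul_measure] at h2
  simp only [toLin'_apply] at h2
  rw [← h2, ENNReal.toReal_ofReal (abs_nonneg _), abs_inv]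
  simp

theorem integral_cexp_dotProduct_sub_dotProduct_self {ι : Type*} [Fintype ι] (z : ι → ℝ) :
    ∫ w : ι → ℝ, Complex.exp (Complex.I * (w ⬝ᵥ z : ℝ) - ((w ⬝ᵥ w : ℝ) : ℂ) / 2) =
      ((√((2 * Real.pi) ^ Fintype.card ι) * Real.exp (-(z ⬝ᵥ z) / 2) : ℝ) : ℂ) := by
  have h := GaussianFourier.integral_cexp_neg_mul_sum_add (ι := ι) (b := 1 / 2) (by norm_num)
    (fun i => Complex.I * z i)
  have e1 : ∀ w : ι → ℝ, -(1 / 2 : ℂ) * ∑ i, (w i : ℂ) ^ 2 + ∑ i, Complex.I * z i * w i =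
      Complex.I * (w ⬝ᵥ z : ℝ) - ((w ⬝ᵥ w : ℝ) : ℂ) / 2 := by
    intro w
    simp only [dotProduct]
    push_cast
    rw [Finset.mul_sum, Finset.mul_sum, Finset.sum_div, ← Finset.sum_add_distrib,
      ← Finset.sum_sub_distrib]
    exact Finset.sum_congr rfl fun i _ => by ring
  simp only [e1] at h
  rw [h]
  push_cast
  congr 1
  · rw [Real.sqrt_eq_rpow, ← Real.rpow_natCast, ← Real.rpow_mul (by positivity),
      Complex.ofReal_cpow (by positivity)]
    push_cast
    congr 1 <;> ring
  · congr 1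
    simp only [dotProduct, mul_pow, Complex.I_sq]
    push_cast
    rw [← Finset.sum_neg_distrib, Finset.sum_div, Finset.sum_div]
    exact Finset.sum_congr rfl fun i _ => by ring

theorem integrable_cexp_neg_quadratic {C : Matrix ι ι ℝ} (hC : C.PosDef) :
    Integrable fun u : ι → ℝ => Complex.exp (-((u ⬝ᵥ (C *ᵥ u) : ℝ) : ℂ) / 2) := by
  obtain ⟨A, hA, rfl⟩ := exists_transpose_mul_self_eq hC
  have h := Real.map_matrix_volume_pi_eq_smul_volume_pi hA.ne_zero
  have he := measurableEmbedding_toLin' hA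
  have h0 := GaussianFourier.integrable_cexp_neg_mul_sum_add (ι := ι) (b := 1 / 2) (by norm_num) 0
  have h1 := (h0.smul_measure (c := ENNReal.ofReal |A.det⁻¹|) ENNReal.ofReal_ne_top)
  rw [← h, he.integrable_map_iff] at h1
  refine h1.congr (ae_of_all _ fun u => ?_)
  have : u ⬝ᵥ ((Aᵀ * A) *ᵥ u) = (A *ᵥ u) ⬝ᵥ (A *ᵥ u) := by
    rw [← mulVec_mulVec, dotProduct_mulVec, vecMul_transpose]
  simp only [Function.comp_apply, toLin'_apply, this]
  congr 1
  simp only [dotProduct]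
  push_cast
  simp only [Pi.zero_apply, zero_mul, Finset.sum_const_zero, add_zero, ← sq]
  ring

/-- Fourier inversion for the normal density. With `C = A'A` and `w = Au` the integral becomes the
standard one, and the Jacobian `|det A|⁻¹` is `(det C)^(-1/2)`. -/
theorem integral_cexp_dotProduct_sub_quadratic {C : Matrix ι ι ℝ} (hC : C.PosDef) (y : ι → ℝ) :
    ∫ u : ι → ℝ, Complex.exp (Complex.I * (u ⬝ᵥ y : ℝ) - ((u ⬝ᵥ (C *ᵥ u) : ℝ) : ℂ) / 2) =
      (((2 * Real.pi) ^ Fintype.card ι * gaussDensity y C : ℝ) : ℂ) := by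
  obtain ⟨A, hA, rfl⟩ := exists_transpose_mul_self_eq hC
  have hAT : IsUnit Aᵀ.det := by rwa [det_transpose]
  have h1 : ∀ u : ι → ℝ, u ⬝ᵥ ((Aᵀ * A) *ᵥ u) = (A *ᵥ u) ⬝ᵥ (A *ᵥ u) := fun u => by
    rw [← mulVec_mulVec, dotProduct_mulVec, vecMul_transpose]
  have h2 : ∀ u : ι → ℝ, u ⬝ᵥ y = (A *ᵥ u) ⬝ᵥ (Aᵀ⁻¹ *ᵥ y) := fun u => by
    rw [← vecMul_transpose, ← dotProduct_mulVec, mulVec_mulVec, mul_nonsing_inv _ hAT, one_mulVec]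
  simp only [h1, h2]
  rw [integral_comp_mulVec hA (fun w => Complex.exp
    (Complex.I * (w ⬝ᵥ (Aᵀ⁻¹ *ᵥ y) : ℝ) - ((w ⬝ᵥ w : ℝ) : ℂ) / 2)),
    integral_cexp_dotProduct_sub_dotProduct_self, gaussDensity]
  have h3 : y ⬝ᵥ ((Aᵀ * A)⁻¹ *ᵥ y) = (Aᵀ⁻¹ *ᵥ y) ⬝ᵥ (Aᵀ⁻¹ *ᵥ y) := by
    rw [Matrix.mul_inv_rev, ← mulVec_mulVec, dotProduct_mulVec, ← mulVec_transpose,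
      transpose_nonsing_inv]
  rw [h3, det_mul, det_transpose, Real.sqrt_mul (by positivity), Real.sqrt_mul_self_eq_abs,
    ← Complex.ofReal_mul]
  congr 1
  have h4 : √((2 * Real.pi) ^ Fintype.card ι) * √((2 * Real.pi) ^ Fintype.card ι) =
      (2 * Real.pi) ^ Fintype.card ι := Real.mul_self_sqrt (by positivity)
  have h5 : |A.det| ≠ 0 := by simpa using hA.ne_zero
  have h6 : √((2 * Real.pi) ^ Fintype.card ι) ≠ 0 := by positivity
  nth_rewrite 2 [← h4]
  field_simp

/-- The convolution of a normal density with a (possibly degenerate) normal law which is given by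
its characteristic function. -/
theorem integral_gaussDensity_of_charFun {Ω : Type*} [MeasurableSpace Ω] {P : Measure Ω}
    [IsProbabilityMeasure P] {ξ : Ω → κ → ℝ} (hξ : AEMeasurable ξ P) {m : κ → ℝ}
    {C : Matrix κ κ ℝ} (hC : C.PosSemidef)
    (hchar : ∀ w : κ → ℝ, ∫ ω, Complex.exp (Complex.I * (w ⬝ᵥ ξ ω : ℝ)) ∂P =
      Complex.exp (Complex.I * (w ⬝ᵥ m : ℝ) - ((w ⬝ᵥ (C *ᵥ w) : ℝ) : ℂ) / 2))
    {Q : Matrix ι ι ℝ} (hQ : Q.PosDef) (L : Matrix ι κ ℝ) (v : ι → ℝ) :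
    ∫ ω, gaussDensity (v - L *ᵥ ξ ω) Q ∂P = gaussDensity (v - L *ᵥ m) (Q + L * C * Lᵀ) := by
  have hQC : (Q + L * C * Lᵀ).PosDef := by
    refine hQ.add_posSemidef ?_
    simpa [conjTranspose_eq_transpose_of_trivial] using hC.mul_mul_conjTranspose_same L
  -- The modulus of the integrand is a Gaussian in `p.2` alone, which is integrable on the product
  -- since `P` is finite.
  have hint : Integrable (fun p : Ω × (ι → ℝ) => Complex.exp
      (Complex.I * (p.2 ⬝ᵥ (v - L *ᵥ ξ p.1) : ℝ) - ((p.2 ⬝ᵥ (Q *ᵥ p.2) : ℝ) : ℂ) / 2))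
      (P.prod volume) := by
    have h := (integrable_cexp_neg_quadratic hQ).comp_snd P
    refine h.norm.mono' ?_ (ae_of_all _ fun p => ?_)
    · have hm : AEMeasurable (fun p : Ω × (ι → ℝ) => (p.2, ξ p.1)) (P.prod volume) :=
        measurable_snd.aemeasurable.prodMk hξ.comp_fst
      have h1 : AEMeasurable (fun p : Ω × (ι → ℝ) => p.2 ⬝ᵥ (v - L *ᵥ ξ p.1)) (P.prod volume) :=
        (Continuous.measurable (f := fun q : (ι → ℝ) × (κ → ℝ) => q.1 ⬝ᵥ (v - L *ᵥ q.2))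
          (continuous_fst.dotProduct (continuous_const.sub
            (continuous_const.matrix_mulVec continuous_snd)))).comp_aemeasurable hm
      have h2 : AEMeasurable (fun p : Ω × (ι → ℝ) => p.2 ⬝ᵥ (Q *ᵥ p.2)) (P.prod volume) :=
        (Continuous.measurable (f := fun q : (ι → ℝ) × (κ → ℝ) => q.1 ⬝ᵥ (Q *ᵥ q.1))
          (continuous_fst.dotProduct
            (continuous_const.matrix_mulVec continuous_fst))).comp_aemeasurable hm
      exact (Complex.measurable_exp.comp_aemeasurable
        (((Complex.measurable_ofReal.comp_aemeasurable h1).const_mul Complex.I).sub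
          ((Complex.measurable_ofReal.comp_aemeasurable h2).div_const 2))).aestronglyMeasurable
    · rw [Complex.norm_exp, Complex.norm_exp]
      simp [neg_div]
  have key : (((2 * Real.pi) ^ Fintype.card ι * ∫ ω, gaussDensity (v - L *ᵥ ξ ω) Q ∂P : ℝ) : ℂ) =
      (((2 * Real.pi) ^ Fintype.card ι * gaussDensity (v - L *ᵥ m) (Q + L * C * Lᵀ) : ℝ) : ℂ) := by
    rw [← integral_const_mul, ← integral_complex_ofReal, ← integral_cexp_dotProduct_sub_quadratic hQC]
    simp only [← integral_cexp_dotProduct_sub_quadratic hQ]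
    rw [integral_integral_swap hint]
    refine integral_congr_ae (ae_of_all _ fun u => ?_)
    -- For fixed `u` the dependence on `ω` is the character with frequency `-u'L`, to which `hchar`
    -- applies.
    have e1 : ∀ ω, Complex.exp (Complex.I * (u ⬝ᵥ (v - L *ᵥ ξ ω) : ℝ) -
        ((u ⬝ᵥ (Q *ᵥ u) : ℝ) : ℂ) / 2) =
        Complex.exp (Complex.I * (u ⬝ᵥ v : ℝ) - ((u ⬝ᵥ (Q *ᵥ u) : ℝ) : ℂ) / 2) *
          Complex.exp (Complex.I * ((-(u ᵥ* L)) ⬝ᵥ ξ ω : ℝ)) := by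
      intro ω
      rw [← Complex.exp_add, dotProduct_sub, dotProduct_mulVec, neg_dotProduct]
      push_cast
      ring_nf
    simp only [e1]
    rw [integral_const_mul, hchar, ← Complex.exp_add]
    congr 1
    have e2 : u ⬝ᵥ ((Q + L * C * Lᵀ) *ᵥ u) = u ⬝ᵥ (Q *ᵥ u) + (-(u ᵥ* L)) ⬝ᵥ (C *ᵥ (-(u ᵥ* L))) := by
      rw [add_mulVec, dotProduct_add, ← mulVec_mulVec, ← mulVec_mulVec, mulVec_transpose,
        mulVec_neg, neg_dotProduct_neg, dotProduct_mulVec u L]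
    rw [e2, dotProduct_sub, dotProduct_mulVec u L m, neg_dotProduct (u ᵥ* L) m]
    push_cast
    ring
  have h0 : (2 * Real.pi) ^ Fintype.card ι ≠ 0 := by positivity
  exact mul_left_cancel₀ h0 (Complex.ofReal_injective key)

end GaussianDensity

/-! ### Gradient and Hessian of the log-density; products of normal densities -/

section LogDensity

variable {ι : Type*} [Fintype ι] [DecidableEq ι] {d : ℕ}

/-- Once differentiability is known, a directional derivative is the linear coefficient along a
line; this replaces differentiating matrix expressions. -/
theorem fderiv_apply_eq_of_quadratic {E : Type*} [NormedAddCommGroup E] [NormedSpace ℝ E]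
    {f : E → ℝ} {x v : E} (hf : DifferentiableAt ℝ f x) {a b : ℝ}
    (h : ∀ t : ℝ, f (x + t • v) = f x + t * a + t ^ 2 * b) : fderiv ℝ f x v = a := by
  rw [← hf.lineDeriv_eq_fderiv, lineDeriv]
  simp only [h]
  have h1 : HasDerivAt (fun t : ℝ => f x + t * a + t ^ 2 * b) (1 * a + (2 * (0 : ℝ)) * b) 0 := by
    refine HasDerivAt.add ?_ ?_
    · exact ((hasDerivAt_id (0 : ℝ)).mul_const a).const_add (f x)
    · simpa using! (hasDerivAt_pow 2 (0 : ℝ)).mul_const b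
  rw [h1.deriv]
  ring

theorem contDiff_quadraticForm {ι : Type*} [Fintype ι] (z : ι → ℝ) (L : Matrix ι (Fin d) ℝ) (M : Matrix ι ι ℝ) :
    ContDiff ℝ 2 fun x : Fin d → ℝ => (z - L *ᵥ x) ⬝ᵥ (M *ᵥ (z - L *ᵥ x)) := by
  simp only [dotProduct, mulVec, Pi.sub_apply]
  fun_prop

theorem quadraticForm_add_smul {ι : Type*} [Fintype ι] {M : Matrix ι ι ℝ} (hM : Mᵀ = M) (z : ι → ℝ)
    (L : Matrix ι (Fin d) ℝ) (x v : Fin d → ℝ) (t : ℝ) :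
    (z - L *ᵥ (x + t • v)) ⬝ᵥ (M *ᵥ (z - L *ᵥ (x + t • v))) =
      (z - L *ᵥ x) ⬝ᵥ (M *ᵥ (z - L *ᵥ x)) + t * (-2 * ((L *ᵥ v) ⬝ᵥ (M *ᵥ (z - L *ᵥ x)))) +
        t ^ 2 * ((L *ᵥ v) ⬝ᵥ (M *ᵥ (L *ᵥ v))) := by
  have e : z - L *ᵥ (x + t • v) = (z - L *ᵥ x) - t • (L *ᵥ v) := by
    rw [mulVec_add, mulVec_smul]; abel
  have hs : (z - L *ᵥ x) ⬝ᵥ (M *ᵥ (L *ᵥ v)) = (L *ᵥ v) ⬝ᵥ (M *ᵥ (z - L *ᵥ x)) := by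
    rw [dotProduct_mulVec, ← mulVec_transpose, hM, dotProduct_comm]
  rw [e, mulVec_sub, mulVec_smul, sub_dotProduct, dotProduct_sub, dotProduct_sub, dotProduct_smul,
    smul_dotProduct, smul_dotProduct, dotProduct_smul, hs]
  simp only [smul_eq_mul]
  ring

theorem log_gaussDensity {C : Matrix ι ι ℝ} (hC : C.PosDef) (y : ι → ℝ) :
    Real.log (gaussDensity y C) = Real.log (√((2 * Real.pi) ^ Fintype.card ι * C.det))⁻¹ +
      (-1 / 2) * (y ⬝ᵥ (C⁻¹ *ᵥ y)) := by
  have := hC.det_pos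
  rw [gaussDensity, Real.log_mul (by positivity) (Real.exp_pos _).ne', Real.log_exp]
  ring

theorem transpose_inv_eq_of_posDef {C : Matrix ι ι ℝ} (hC : C.PosDef) : (C⁻¹)ᵀ = C⁻¹ := by
  have := hC.inv.isHermitian
  rwa [Matrix.IsHermitian, conjTranspose_eq_transpose_of_trivial] at this

theorem contDiff_log_gaussDensity {C : Matrix ι ι ℝ} (hC : C.PosDef) (z : ι → ℝ)
    (L : Matrix ι (Fin d) ℝ) :
    ContDiff ℝ 2 fun x : Fin d → ℝ => Real.log (gaussDensity (z - L *ᵥ x) C) := by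
  simp only [log_gaussDensity hC]
  exact contDiff_const.add (contDiff_const.mul (contDiff_quadraticForm z L C⁻¹))

theorem grad_log_gaussDensity {C : Matrix ι ι ℝ} (hC : C.PosDef) (z : ι → ℝ)
    (L : Matrix ι (Fin d) ℝ) (x : Fin d → ℝ) :
    grad (fun y => Real.log (gaussDensity (z - L *ᵥ y) C)) x =
      (Lᵀ * C⁻¹) *ᵥ (z - L *ᵥ x) := by
  ext i
  refine fderiv_apply_eq_of_quadratic (b := (-1 / 2) *
      ((L *ᵥ Pi.single i 1) ⬝ᵥ (C⁻¹ *ᵥ (L *ᵥ Pi.single i 1))))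
    ((contDiff_log_gaussDensity hC z L).differentiable (by norm_num) x) fun t => ?_
  have h : ((Lᵀ * C⁻¹) *ᵥ (z - L *ᵥ x)) i =
      (L *ᵥ Pi.single i 1) ⬝ᵥ (C⁻¹ *ᵥ (z - L *ᵥ x)) := by
    rw [← mulVec_mulVec, mulVec_single_one]
    rfl
  rw [log_gaussDensity hC, log_gaussDensity hC,
    quadraticForm_add_smul (transpose_inv_eq_of_posDef hC), h]
  ring

theorem hess_log_gaussDensity {C : Matrix ι ι ℝ} (hC : C.PosDef) (z : ι → ℝ)
    (L : Matrix ι (Fin d) ℝ) (x : Fin d → ℝ) :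
    hess (fun y => Real.log (gaussDensity (z - L *ᵥ y) C)) x = -(Lᵀ * C⁻¹ * L) := by
  have hs : (Lᵀ * C⁻¹ * L)ᵀ = Lᵀ * C⁻¹ * L := by
    rw [transpose_mul, transpose_mul, transpose_inv_eq_of_posDef hC, transpose_transpose,
      Matrix.mul_assoc]
  ext i j
  simp only [hess, of_apply, grad_log_gaussDensity hC]
  -- The gradient is affine in the point, so there is no quadratic term.
  refine fderiv_apply_eq_of_quadratic (b := 0) ?_ fun t => ?_
  · simp only [mulVec, dotProduct, Pi.sub_apply]
    fun_prop
  · rw [← hs, Matrix.neg_apply, transpose_apply, mulVec_add, mulVec_smul, mulVec_single_one, ← sub_sub,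
      mulVec_sub, mulVec_smul]
    simp only [Pi.sub_apply, Pi.smul_apply, smul_eq_mul, col_def, mulVec, Matrix.mul_apply,
      dotProduct, transpose_apply]
    ring

theorem dotProduct_sumElim_mulVec_fromBlocks {ι κ : Type*} [Fintype ι] [Fintype κ]
    (y : ι → ℝ) (z : κ → ℝ) (A : Matrix ι ι ℝ) (B : Matrix κ κ ℝ) :
    Sum.elim y z ⬝ᵥ (fromBlocks A 0 0 B *ᵥ Sum.elim y z) = y ⬝ᵥ (A *ᵥ y) + z ⬝ᵥ (B *ᵥ z) := by
  rw [fromBlocks_mulVec, sumElim_dotProduct_sumElim]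
  simp

/-- For a block diagonal covariance the inverse is block diagonal, the determinant is the product
and the quadratic forms add. This merges the two observations into one. -/
theorem gaussDensity_mul_gaussDensity {κ : Type*} [Fintype κ] [DecidableEq κ]
    {A : Matrix ι ι ℝ} {B : Matrix κ κ ℝ} (hA : A.PosDef) (hB : B.PosDef) (y : ι → ℝ) (z : κ → ℝ) :
    gaussDensity y A * gaussDensity z B = gaussDensity (Sum.elim y z) (fromBlocks A 0 0 B) := by
  have hA' := hA.isUnit
  have hB' := hB.isUnit
  have hdA := hA.det_pos
  have hdB := hB.det_pos
  have hinv : (fromBlocks A 0 0 B)⁻¹ = fromBlocks A⁻¹ 0 0 B⁻¹ := by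
    refine inv_eq_right_inv ?_
    rw [fromBlocks_multiply]
    simp [mul_nonsing_inv _ ((isUnit_iff_isUnit_det _).1 hA'),
      mul_nonsing_inv _ ((isUnit_iff_isUnit_det _).1 hB')]
  rw [gaussDensity, gaussDensity, gaussDensity, hinv, dotProduct_sumElim_mulVec_fromBlocks,
    det_fromBlocks_zero₂₁, mul_mul_mul_comm, ← Real.exp_add, ← mul_inv,
    ← Real.sqrt_mul (by positivity), Fintype.card_sum, pow_add]
  congr 1
  · rw [mul_mul_mul_comm]
  · congr 1; ring

theorem posDef_fromBlocks {ι κ : Type*} [Fintype ι] [Fintype κ]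
    {A : Matrix ι ι ℝ} {B : Matrix κ κ ℝ} (hA : A.PosDef) (hB : B.PosDef) :
    (fromBlocks A 0 0 B).PosDef := by
  have hA0 := hA.isHermitian
  have hB0 := hB.isHermitian
  refine PosDef.of_dotProduct_mulVec_pos ?_ fun {x} hx => ?_
  · rw [Matrix.IsHermitian, fromBlocks_conjTranspose, hA0, hB0]; simp
  · obtain ⟨y, z, rfl⟩ : ∃ y z, x = Sum.elim y z := ⟨x ∘ Sum.inl, x ∘ Sum.inr, by simp⟩
    rw [star_trivial, dotProduct_sumElim_mulVec_fromBlocks]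
    have h1 := hA.posSemidef.dotProduct_mulVec_nonneg y
    have h2 := hB.posSemidef.dotProduct_mulVec_nonneg z
    rw [star_trivial] at h1 h2
    by_cases hy : y = 0
    · have hz : z ≠ 0 := fun hz => hx (by subst hy hz; ext (i | i) <;> rfl)
      have := hB.dotProduct_mulVec_pos hz
      rw [star_trivial] at this
      linarith
    · have := hA.dotProduct_mulVec_pos hy
      rw [star_trivial] at this
      linarith

end LogDensity

/-! ### Wiener integrals of deterministic kernels and their normal law -/

section WienerPairs

variable {Ω : Type*} {d' : ℕ} {W : Fin d' → ℝ≥0 → Ω → ℝ}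

/-- The kernel `1_{(0,b]}` in the component `j`, with its integral `W_j(b)`. -/
noncomputable def brownianPair (W : Fin d' → ℝ≥0 → Ω → ℝ) (p : Fin d' × ℝ≥0) :
    (Fin d' → ℝ → ℝ) × (Ω → ℝ) :=
  (Pi.single p.1 ((Ioc 0 (p.2 : ℝ)).indicator fun _ => 1), W p.1 p.2)

/-- The pairs of a vector of step kernels with its elementary integral. -/
noncomputable def elemPairs (W : Fin d' → ℝ≥0 → Ω → ℝ) :
    Submodule ℝ ((Fin d' → ℝ → ℝ) × (Ω → ℝ)) :=
  Submodule.span ℝ (range (brownianPair W))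

theorem memLp_brownianPair_fst (p : Fin d' × ℝ≥0) (j : Fin d') :
    MemLp ((brownianPair W p).1 j) 2 volume := by
  rcases eq_or_ne j p.1 with rfl | h
  · simp only [brownianPair, Pi.single_eq_same]
    exact memLp_indicator_const 2 measurableSet_Ioc 1 (Or.inr (by simp))
  · simp only [brownianPair, Pi.single_eq_of_ne h]
    exact MemLp.zero

theorem memLp_fst_of_mem_elemPairs {e : (Fin d' → ℝ → ℝ) × (Ω → ℝ)}
    (he : e ∈ elemPairs W) (j : Fin d') : MemLp (e.1 j) 2 volume := by
  induction he using Submodule.span_induction with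
  | mem x hx => obtain ⟨p, rfl⟩ := hx; exact memLp_brownianPair_fst p j
  | zero => exact MemLp.zero
  | add x y _ _ hx hy => exact hx.add hy
  | smul c x _ hx => exact hx.const_smul c

/-- Each `1_{(p,q]}` is a difference of generators `1_{(0,q]}` and `1_{(0,p]}`. Nonnegative points
are needed for this, and also for `toNNReal` to preserve them. -/
theorem stepFn_mem_elemPairs (j : Fin d') (h : StepFn) (h0 : ∀ k, 0 ≤ h.pt k) :
    ((Pi.single j h.toFun, h.integral (W j)) : (Fin d' → ℝ → ℝ) × (Ω → ℝ)) ∈ elemPairs W := by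
  have hs : ((Pi.single j h.toFun, h.integral (W j)) : (Fin d' → ℝ → ℝ) × (Ω → ℝ)) =
      ∑ k ∈ Finset.range h.len, h.val k • (brownianPair W (j, (h.pt (k + 1)).toNNReal) -
        brownianPair W (j, (h.pt k).toNNReal)) := by
    refine Prod.ext ?_ ?_
    · rw [Prod.fst_sum]
      ext i u
      rcases eq_or_ne i j with rfl | hij
      · simp only [Pi.single_eq_same, StepFn.toFun, Finset.sum_apply, Prod.smul_fst, Prod.fst_sub,
          Pi.smul_apply, Pi.sub_apply, brownianPair, smul_eq_mul, Real.coe_toNNReal _ (h0 _)]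
        refine Finset.sum_congr rfl fun k _ => ?_
        have hk := h.mono (Nat.le_succ k)
        have := h0 k
        simp only [Nat.succ_eq_add_one] at hk
        simp only [indicator_apply, mem_Ioc]
        split_ifs <;> grind
      · simp [brownianPair, Pi.single_eq_of_ne hij]
    · rw [Prod.snd_sum]
      ext ω
      simp [StepFn.integral, brownianPair]
  rw [hs]
  exact sum_mem fun k _ => Submodule.smul_mem _ _ (sub_mem
    (Submodule.subset_span (mem_range_self _)) (Submodule.subset_span (mem_range_self _)))

variable [MeasurableSpace Ω] {P : Measure Ω}

theorem IsBrownianVector.integral_eval (hW : IsBrownianVector P W) (p : Fin d' × ℝ≥0) :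
    ∫ ω, W p.1 p.2 ω ∂P = 0 :=
  (hW.1 p.1).integral_eval p.2

theorem IsBrownianVector.isGaussianProcess [IsProbabilityMeasure P] (hW : IsBrownianVector P W) :
    IsGaussianProcess (fun p : Fin d' × ℝ≥0 => W p.1 p.2) P where
  hasGaussianLaw I := by
    classical
    -- Every component is taken at all the times in `I`, so that independence gives one Gaussian
    -- vector from which the pairs in `I` are selected linearly.
    let J : Finset ℝ≥0 := I.image Prod.snd
    have h1 : ∀ j, HasGaussianLaw (fun ω => J.restrict (W j · ω)) P := fun j =>
      (IsPreBrownianReal.isGaussianProcess (hW.1 j).toIsPreBrownianReal).hasGaussianLaw J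
    have h2 : iIndepFun (fun j ω => J.restrict (W j · ω)) P :=
      hW.2.comp (fun _ x => J.restrict x) fun _ => Finset.measurable_restrict J
    have h3 := iIndepFun.hasGaussianLaw h1 h2
    let K : (Fin d' → J → ℝ) →L[ℝ] (I → ℝ) :=
      { toFun := fun x p => x p.1.1 ⟨p.1.2, Finset.mem_image_of_mem _ p.2⟩
        map_add' := fun x y => by ext; simp
        map_smul' := fun c x => by ext; simp }
    exact h3.map K

variable [IsProbabilityMeasure P]

theorem IsBrownianVector.memLp_eval (hW : IsBrownianVector P W) (p : Fin d' × ℝ≥0) :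
    MemLp (W p.1 p.2) 2 P :=
  (hW.isGaussianProcess.hasGaussianLaw_eval p).memLp_two

theorem IsBrownianVector.memLp_snd (hW : IsBrownianVector P W) {e : (Fin d' → ℝ → ℝ) × (Ω → ℝ)}
    (he : e ∈ elemPairs W) : MemLp e.2 2 P := by
  induction he using Submodule.span_induction with
  | mem x hx => obtain ⟨p, rfl⟩ := hx; exact hW.memLp_eval p
  | zero => exact MemLp.zero
  | add x y _ _ hx hy => exact hx.add hy
  | smul c x _ hx => exact hx.const_smul c

/-- The isometry on generators: `min a b` is the length of `(0,a] ∩ (0,b]`, and distinct components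
are independent and centred. -/
theorem IsBrownianVector.integral_eval_mul_eval (hW : IsBrownianVector P W)
    (p q : Fin d' × ℝ≥0) :
    ∫ ω, W p.1 p.2 ω * W q.1 q.2 ω ∂P =
      ∑ j, ∫ u, (brownianPair W p).1 j u * (brownianPair W q).1 j u := by
  obtain ⟨i, a⟩ := p
  obtain ⟨j, b⟩ := q
  rcases eq_or_ne i j with rfl | hij
  · have h1 := (hW.1 i).covariance_eval a b
    rw [covariance_eq_sub (hW.memLp_eval (i, a)) (hW.memLp_eval (i, b)), (hW.1 i).integral_eval,
      zero_mul, sub_zero] at h1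
    have h2 : ∫ ω, W i a ω * W i b ω ∂P = min (a : ℝ) b := by
      simpa using h1
    rw [Finset.sum_eq_single i]
    · simp only [brownianPair, Pi.single_eq_same]
      rw [h2]
      have : ∀ u : ℝ, (Ioc 0 (a : ℝ)).indicator (fun _ => (1 : ℝ)) u *
          (Ioc 0 (b : ℝ)).indicator (fun _ => 1) u =
          (Ioc 0 (min (a : ℝ) b)).indicator (fun _ => 1) u := by
        intro u
        simp only [indicator_apply, mem_Ioc, le_min_iff]
        split_ifs <;> grind
      simp only [this]
      rw [integral_indicator measurableSet_Ioc]
      simp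
    · intro k _ hk
      simp [brownianPair, Pi.single_eq_of_ne hk]
    · simp
  · have h1 : IndepFun (W i a) (W j b) P :=
      (hW.2.indepFun hij).comp (φ := fun x : ℝ≥0 → ℝ => x a) (ψ := fun x : ℝ≥0 → ℝ => x b)
        (measurable_pi_apply a) (measurable_pi_apply b)
    have h2 := h1.integral_mul_eq_mul_integral (hW.memLp_eval (i, a)).1 (hW.memLp_eval (j, b)).1
    rw [(hW.1 i).integral_eval, zero_mul] at h2
    refine Eq.trans h2 (Finset.sum_eq_zero fun k _ => ?_).symm
    rcases eq_or_ne k i with rfl | hk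
    · simp [brownianPair, Pi.single_eq_of_ne hij]
    · simp [brownianPair, Pi.single_eq_of_ne hk]

/-- Finite linear combinations of a Gaussian process are normal, so only mean and variance are left;
expanding both squares reduces the variance to the isometry on generators. -/
theorem IsBrownianVector.map_elemPairs (hW : IsBrownianVector P W)
    {e : (Fin d' → ℝ → ℝ) × (Ω → ℝ)} (he : e ∈ elemPairs W) :
    P.map e.2 = gaussianReal 0 (∑ j, ∫ u, e.1 j u ^ 2).toNNReal := by
  obtain ⟨c, rfl⟩ := Finsupp.mem_span_range_iff_exists_finsupp.1 he
  have hsnd : (c.sum fun p a => a • brownianPair W p).2 =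
      fun ω => ∑ p ∈ c.support, c p * W p.1 p.2 ω := by
    ext ω
    simp [Finsupp.sum, Prod.snd_sum, brownianPair]
  have hfst : ∀ j, (c.sum fun p a => a • brownianPair W p).1 j =
      fun u => ∑ p ∈ c.support, c p * (brownianPair W p).1 j u := by
    intro j
    ext u
    simp [Finsupp.sum, Prod.fst_sum]
  have hG : HasGaussianLaw (c.sum fun p a => a • brownianPair W p).2 P := by
    rw [hsnd]
    exact (hW.isGaussianProcess.smul fun p => c p).hasGaussianLaw_fun_sum (I := c.support)
  have hmean : ∫ ω, (c.sum fun p a => a • brownianPair W p).2 ω ∂P = 0 := by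
    simp only [hsnd]
    rw [integral_finsetSum _ fun p _ => ((hW.memLp_eval p).integrable (by norm_num)).const_mul _]
    exact Finset.sum_eq_zero fun p _ => by rw [integral_const_mul, hW.integral_eval, mul_zero]
  rw [hG.map_eq_gaussianReal, hmean, variance_of_integral_eq_zero hG.aemeasurable hmean]
  congr 2
  have hL : ∀ ω, (c.sum fun p a => a • brownianPair W p).2 ω ^ 2 =
      ∑ p ∈ c.support, ∑ q ∈ c.support, (c p * c q) * (W p.1 p.2 ω * W q.1 q.2 ω) := by
    intro ω
    rw [hsnd, sq, Finset.sum_mul_sum]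
    exact Finset.sum_congr rfl fun p _ => Finset.sum_congr rfl fun q _ => by ring
  have hR : ∀ j u, (c.sum fun p a => a • brownianPair W p).1 j u ^ 2 =
      ∑ p ∈ c.support, ∑ q ∈ c.support,
        (c p * c q) * ((brownianPair W p).1 j u * (brownianPair W q).1 j u) := by
    intro j u
    rw [hfst, sq, Finset.sum_mul_sum]
    exact Finset.sum_congr rfl fun p _ => Finset.sum_congr rfl fun q _ => by ring
  have hi1 : ∀ p q, Integrable (fun ω => (c p * c q) * (W p.1 p.2 ω * W q.1 q.2 ω)) P :=
    fun p q => ((hW.memLp_eval p).integrable_mul (hW.memLp_eval q)).const_mul _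
  have hi2 : ∀ j p q, Integrable (fun u => (c p * c q) *
      ((brownianPair W p).1 j u * (brownianPair W q).1 j u)) volume :=
    fun j p q => ((memLp_brownianPair_fst p j).integrable_mul (memLp_brownianPair_fst q j)).const_mul _
  simp only [hL, hR]
  rw [integral_finsetSum _ fun p _ => integrable_finsetSum _ fun q _ => hi1 p q]
  have e2 : ∀ j, ∫ u, ∑ p ∈ c.support, ∑ q ∈ c.support,
      (c p * c q) * ((brownianPair W p).1 j u * (brownianPair W q).1 j u) =
      ∑ p ∈ c.support, ∑ q ∈ c.support,
        (c p * c q) * ∫ u, (brownianPair W p).1 j u * (brownianPair W q).1 j u := by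
    intro j
    rw [integral_finsetSum _ fun p _ => integrable_finsetSum _ fun q _ => hi2 j p q]
    refine Finset.sum_congr rfl fun p _ => ?_
    rw [integral_finsetSum _ fun q _ => hi2 j p q]
    exact Finset.sum_congr rfl fun q _ => integral_const_mul _ _
  simp only [e2]
  rw [Finset.sum_comm]
  refine Finset.sum_congr rfl fun p _ => ?_
  rw [integral_finsetSum _ fun q _ => hi1 p q, Finset.sum_comm]
  refine Finset.sum_congr rfl fun q _ => ?_
  rw [integral_const_mul, hW.integral_eval_mul_eval, Finset.mul_sum]

/-- The closure in `L²` of the elementary pairs: square integrable kernels with their integrals. -/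
noncomputable def wienerPairs (hW : IsBrownianVector P W) :
    Submodule ℝ ((Fin d' → ℝ → ℝ) × (Ω → ℝ)) where
  carrier := {z | (∀ j, MemLp (z.1 j) 2 volume) ∧ MemLp z.2 2 P ∧
    ∃ e : ℕ → (Fin d' → ℝ → ℝ) × (Ω → ℝ), (∀ n, e n ∈ elemPairs W) ∧
      (∀ j, Tendsto (fun n => eLpNorm ((e n).1 j - z.1 j) 2 volume) atTop (𝓝 0)) ∧
      Tendsto (fun n => eLpNorm ((e n).2 - z.2) 2 P) atTop (𝓝 0)}
  zero_mem' := ⟨fun _ => MemLp.zero, MemLp.zero, fun _ => 0, fun _ => zero_mem _,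
    fun j => by simp, by simp⟩
  add_mem' := by
    rintro x y ⟨hx1, hx2, e, he, hex1, hex2⟩ ⟨hy1, hy2, f, hf, hfy1, hfy2⟩
    refine ⟨fun j => (hx1 j).add (hy1 j), hx2.add hy2, fun n => e n + f n,
      fun n => add_mem (he n) (hf n), fun j => ?_, ?_⟩
    · refine tendsto_of_tendsto_of_tendsto_of_le_of_le tendsto_const_nhds
        (by simpa using (hex1 j).add (hfy1 j)) (fun _ => zero_le) fun n => ?_
      have : (e n + f n).1 j - (x + y).1 j = ((e n).1 j - x.1 j) + ((f n).1 j - y.1 j) := by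
        simp; abel
      rw [this]
      exact eLpNorm_add_le ((memLp_fst_of_mem_elemPairs (he n) j).sub (hx1 j)).1
        ((memLp_fst_of_mem_elemPairs (hf n) j).sub (hy1 j)).1 (by norm_num)
    · refine tendsto_of_tendsto_of_tendsto_of_le_of_le tendsto_const_nhds
        (by simpa using hex2.add hfy2) (fun _ => zero_le) fun n => ?_
      have : (e n + f n).2 - (x + y).2 = ((e n).2 - x.2) + ((f n).2 - y.2) := by
        simp; abel
      rw [this]
      exact eLpNorm_add_le ((hW.memLp_snd (he n)).sub hx2).1
        ((hW.memLp_snd (hf n)).sub hy2).1 (by norm_num)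
  smul_mem' := by
    rintro c x ⟨hx1, hx2, e, he, hex1, hex2⟩
    refine ⟨fun j => (hx1 j).const_smul c, hx2.const_smul c, fun n => c • e n,
      fun n => Submodule.smul_mem _ c (he n), fun j => ?_, ?_⟩
    · have : ∀ n, (c • e n).1 j - (c • x).1 j = c • ((e n).1 j - x.1 j) := fun n => by
        simp [smul_sub]
      simp only [this, eLpNorm_const_smul]
      simpa using ENNReal.Tendsto.const_mul (hex1 j) (Or.inr (by simp : ‖c‖ₑ ≠ ∞))
    · have : ∀ n, (c • e n).2 - (c • x).2 = c • ((e n).2 - x.2) := fun n => by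
        simp [smul_sub]
      simp only [this, eLpNorm_const_smul]
      simpa using ENNReal.Tendsto.const_mul hex2 (Or.inr (by simp : ‖c‖ₑ ≠ ∞))

theorem integral_sq_eq_eLpNorm_sq {α : Type*} [MeasurableSpace α] {μ : Measure α} {f : α → ℝ}
    (hf : MemLp f 2 μ) : ∫ x, f x ^ 2 ∂μ = (eLpNorm f 2 μ).toReal ^ 2 := by
  have h := hf.eLpNorm_eq_integral_rpow_norm (by norm_num) (by norm_num)
  rw [h]
  have h0 : 0 ≤ ∫ x, f x ^ 2 ∂μ := integral_nonneg fun x => sq_nonneg _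
  simp only [ENNReal.toReal_ofNat, Real.rpow_two, Real.norm_eq_abs, sq_abs]
  rw [ENNReal.toReal_ofReal (by positivity), ← Real.rpow_natCast, ← Real.rpow_mul h0]
  norm_num

theorem tendsto_integral_sq {α : Type*} [MeasurableSpace α] {μ : Measure α} {f : ℕ → α → ℝ}
    {g : α → ℝ} (hf : ∀ n, MemLp (f n) 2 μ) (hg : MemLp g 2 μ)
    (h : Tendsto (fun n => eLpNorm (f n - g) 2 μ) atTop (𝓝 0)) :
    Tendsto (fun n => ∫ x, f n x ^ 2 ∂μ) atTop (𝓝 (∫ x, g x ^ 2 ∂μ)) := by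
  simp only [integral_sq_eq_eLpNorm_sq (hf _), integral_sq_eq_eLpNorm_sq hg]
  refine Tendsto.pow ?_ 2
  have h' : Tendsto (fun n => (eLpNorm (f n - g) 2 μ).toReal) atTop (𝓝 0) := 
    (ENNReal.tendsto_toReal ENNReal.zero_ne_top).comp h
  refine tendsto_iff_dist_tendsto_zero.2 (squeeze_zero (fun _ => dist_nonneg) (fun n => ?_) h')
  have h1 : eLpNorm (f n) 2 μ ≤ eLpNorm (f n - g) 2 μ + eLpNorm g 2 μ := by
    simpa using eLpNorm_add_le ((hf n).sub hg).1 hg.1 (by norm_num : (1 : ℝ≥0∞) ≤ 2)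
  have h2 : eLpNorm g 2 μ ≤ eLpNorm (f n - g) 2 μ + eLpNorm (f n) 2 μ := by
    rw [eLpNorm_sub_comm]
    simpa using eLpNorm_add_le (hg.sub (hf n)).1 (hf n).1 (by norm_num : (1 : ℝ≥0∞) ≤ 2)
  have t1 := ENNReal.toReal_mono (ENNReal.add_ne_top.2 ⟨((hf n).sub hg).2.ne, hg.2.ne⟩) h1
  have t2 := ENNReal.toReal_mono (ENNReal.add_ne_top.2 ⟨((hf n).sub hg).2.ne, (hf n).2.ne⟩) h2
  rw [ENNReal.toReal_add ((hf n).sub hg).2.ne hg.2.ne] at t1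
  rw [ENNReal.toReal_add ((hf n).sub hg).2.ne (hf n).2.ne] at t2
  rw [Real.dist_eq, abs_le]
  constructor <;> linarith

/-- `L²` convergence gives convergence in measure, so every subsequence has a further one converging
almost everywhere, along which bounded convergence applies. -/
theorem tendsto_integral_cexp {f : ℕ → Ω → ℝ} {g : Ω → ℝ} (hf : ∀ n, AEStronglyMeasurable (f n) P)
    (hg : AEStronglyMeasurable g P)
    (h : Tendsto (fun n => eLpNorm (f n - g) 2 P) atTop (𝓝 0)) :
    Tendsto (fun n => ∫ ω, Complex.exp (Complex.I * f n ω) ∂P) atTop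
      (𝓝 (∫ ω, Complex.exp (Complex.I * g ω) ∂P)) := by
  have hmeas : TendstoInMeasure P f atTop g :=
    tendstoInMeasure_of_tendsto_eLpNorm (by norm_num) hf hg h
  refine tendsto_of_subseq_tendsto fun ns hns => ?_
  obtain ⟨ms, _, hms⟩ := (hmeas.comp hns).exists_seq_tendsto_ae
  refine ⟨ms, tendsto_integral_of_dominated_convergence (fun _ => 1) (fun n => ?_)
    (integrable_const 1) (fun n => ae_of_all _ fun ω => ?_) ?_⟩
  · exact (Complex.continuous_exp.comp (continuous_const.mul
      Complex.continuous_ofReal)).comp_aestronglyMeasurable (hf _)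
  · rw [Complex.norm_exp]; simp
  · filter_upwards [hms] with ω hω
    exact ((Complex.continuous_exp.comp (continuous_const.mul
      Complex.continuous_ofReal)).tendsto _).comp hω

/-- The integral of a deterministic square integrable kernel is centred normal, with variance
the squared `L²`-norm of the kernel. -/
theorem integral_cexp_of_mem_wienerPairs (hW : IsBrownianVector P W)
    {z : (Fin d' → ℝ → ℝ) × (Ω → ℝ)} (hz : z ∈ wienerPairs hW) :
    ∫ ω, Complex.exp (Complex.I * z.2 ω) ∂P =
      Complex.exp (-((∑ j, ∫ u, z.1 j u ^ 2 : ℝ) : ℂ) / 2) := by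
  obtain ⟨h1, h2, e, he, he1, he2⟩ := hz
  have hl := tendsto_integral_cexp (fun n => (hW.memLp_snd (he n)).1) h2.1 he2
  have hr : Tendsto (fun n => ∑ j, ∫ u, (e n).1 j u ^ 2) atTop (𝓝 (∑ j, ∫ u, z.1 j u ^ 2)) :=
    tendsto_finsetSum _ fun j _ =>
      tendsto_integral_sq (fun n => memLp_fst_of_mem_elemPairs (he n) j) (h1 j) (he1 j)
  have hr' := ((Complex.continuous_exp.comp (f := fun x : ℝ => -(x : ℂ) / 2)
    (by fun_prop)).tendsto _).comp hr
  refine tendsto_nhds_unique hl (hr'.congr fun n => ?_)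
  have hm := hW.map_elemPairs (he n)
  -- The required expectation is the characteristic function of the approximant at the argument 1.
  have hc := charFun_gaussianReal (μ := 0) (v := (∑ j, ∫ u, (e n).1 j u ^ 2).toNNReal) 1
  rw [← hm, charFun_apply_real, integral_map (hW.memLp_snd (he n)).1.aemeasurable
    (by fun_prop)] at hc
  have h0 : 0 ≤ ∑ j, ∫ u, (e n).1 j u ^ 2 :=
    Finset.sum_nonneg fun j _ => integral_nonneg fun u => sq_nonneg _
  simp only [Function.comp_apply]
  calc _ = Complex.exp (1 * 0 * Complex.I - ((∑ j, ∫ u, (e n).1 j u ^ 2).toNNReal : ℝ) * 1 ^ 2 / 2) := by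
        rw [Real.coe_toNNReal _ h0]; congr 1; ring
    _ = _ := by
        simpa [mul_comm Complex.I] using hc.symm

theorem congr_ae_mem_wienerPairs (hW : IsBrownianVector P W) {F : Fin d' → ℝ → ℝ} {N N' : Ω → ℝ}
    (h : (F, N) ∈ wienerPairs hW) (hN : N =ᵐ[P] N') : (F, N') ∈ wienerPairs hW := by
  obtain ⟨h1, h2, e, he, he1, he2⟩ := h
  refine ⟨h1, h2.ae_eq hN, e, he, he1, he2.congr fun n => ?_⟩
  exact eLpNorm_congr_ae (EventuallyEq.rfl.sub hN)

/-- The approximating step functions have their points in `[s,t]` and vanish off `(s,t]`, so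
convergence on `(s,t]` is convergence on the whole line to `f` cut off there. -/
theorem IsWienerIntegral.mem_wienerPairs (hW : IsBrownianVector P W) {j : Fin d'} {f : ℝ → ℝ}
    {s t : ℝ} {J : Ω → ℝ} (hs : 0 ≤ s) (hf : MemLp f 2 (volume.restrict (Ioc s t)))
    (hJ : IsWienerIntegral P (W j) f s t J) :
    (Pi.single j ((Ioc s t).indicator f), J) ∈ wienerPairs hW := by
  obtain ⟨hJ2, h, hpt, hh, hi⟩ := hJ
  refine ⟨fun i => ?_, hJ2, fun n => (Pi.single j (h n).toFun, (h n).integral (W j)),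
    fun n => stepFn_mem_elemPairs j (h n) fun k => hs.trans (hpt n k).1, fun i => ?_, hi⟩
  · rcases eq_or_ne i j with rfl | hij
    · simpa only [Pi.single_eq_same] using (memLp_indicator_iff_restrict measurableSet_Ioc).2 hf
    · simp only [Pi.single_eq_of_ne hij]
      exact MemLp.zero
  · rcases eq_or_ne i j with rfl | hij
    · simp only [Pi.single_eq_same]
      refine hh.congr fun n => ?_
      rw [← eLpNorm_indicator_eq_eLpNorm_restrict measurableSet_Ioc]
      congr 1
      ext u
      by_cases hu : u ∈ Ioc s t
      · simp [hu]
      · have h0 : (h n).toFun u = 0 := Finset.sum_eq_zero fun k _ =>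
          indicator_of_notMem (fun hk => hu ⟨(hpt n k).1.trans_lt hk.1,
            hk.2.trans (hpt n (k + 1)).2⟩) _
        simp [hu, h0]
    · simp [Pi.single_eq_of_ne hij]

end WienerPairs

/-! ### Backward Gronwall inequality -/

section Volterra

/-- A backward Gronwall lemma with an integrable weight. -/
theorem eq_zero_of_le_integral_mul {g b : ℝ → ℝ} {v : ℝ} (hg : ContinuousOn g (Icc 0 v))
    (hg0 : ∀ u ∈ Icc 0 v, 0 ≤ g u) (hb0 : ∀ u, 0 ≤ b u) (hb : IntegrableOn b (Icc 0 v))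
    (h : ∀ u ∈ Icc 0 v, g u ≤ ∫ w in u..v, b w * g w) : ∀ u ∈ Icc 0 v, g u = 0 := by
  intro u0 hu0
  have hv : 0 ≤ v := hu0.1.trans hu0.2
  have hbg : IntegrableOn (fun w => b w * g w) (Icc 0 v) := hb.mul_continuousOn hg isCompact_Icc
  have hii : ∀ {f : ℝ → ℝ}, IntegrableOn f (Icc 0 v) → ∀ {p q : ℝ}, p ∈ Icc 0 v → q ∈ Icc 0 v →
      IntervalIntegrable f volume p q := fun hf p q hp hq =>
    (hf.mono_set (uIcc_subset_Icc hp hq)).intervalIntegrable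
  have hcont : ContinuousOn (fun x => ∫ w in (0 : ℝ)..x, b w) (Icc 0 v) := by
    have := intervalIntegral.continuousOn_primitive_interval (μ := volume) (f := b) (a := 0) (b := v)
      (by rwa [uIcc_of_le hv])
    rwa [uIcc_of_le hv] at this
  -- On intervals shorter than `δ` the weight has mass below 1/2. The induction moves down from `v`
  -- in steps of `δ/2`, which keeps the inequality strict.
  obtain ⟨δ, hδ, hδ'⟩ := Metric.uniformContinuousOn_iff.1
    (isCompact_Icc.uniformContinuousOn_of_continuous hcont) (1 / 2) (by norm_num)
  have step : ∀ n : ℕ, ∀ u ∈ Icc 0 v, v - n * (δ / 2) ≤ u → g u = 0 := by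
    intro n
    induction n with
    | zero =>
      intro u hu hle
      have : u = v := le_antisymm hu.2 (by simpa using hle)
      subst this
      exact le_antisymm (by simpa using h u hu) (hg0 u hu)
    | succ n ih =>
      intro u hu hle
      push_cast at hle
      -- To the right of `p`, `g` vanishes by induction; `p` is clipped to `[u,v]`.
      set p := max u (min v (v - n * (δ / 2))) with hp
      have hup : u ≤ p := le_max_left _ _
      have hpv : p ≤ v := max_le hu.2 (min_le_left _ _)
      have hpm : p ∈ Icc 0 v := ⟨hu.1.trans hup, hpv⟩
      have hpδ : p - u ≤ δ / 2 := by
        rcases le_total u (min v (v - n * (δ / 2))) with h1 | h1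
        · rw [hp, max_eq_right h1]
          have := min_le_right v (v - n * (δ / 2))
          linarith
        · rw [hp, max_eq_left h1]; linarith
      have hpz : ∀ w ∈ Icc p v, g w = 0 := fun w hw => ih w ⟨hpm.1.trans hw.1, hw.2⟩ (by
        have h1 : min v (v - n * (δ / 2)) ≤ p := le_max_right _ _
        have h2 : min v (v - n * (δ / 2)) = v - n * (δ / 2) := min_eq_right (by
          have : 0 ≤ (n : ℝ) * (δ / 2) := by positivity
          linarith)
        linarith [hw.1])
      obtain ⟨m, hm, hmax⟩ := isCompact_Icc.exists_isMaxOn (nonempty_Icc.2 hup)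
        (hg.mono (Icc_subset_Icc hu.1 hpv))
      have hm0 : m ∈ Icc 0 v := ⟨hu.1.trans hm.1, hm.2.trans hpv⟩
      have e1 : ∫ w in m..v, b w * g w = ∫ w in m..p, b w * g w := by
        rw [← intervalIntegral.integral_add_adjacent_intervals (hii hbg hm0 hpm)
          (hii hbg hpm ⟨hv, le_rfl⟩), intervalIntegral.integral_congr (g := fun _ => 0)
          (a := p) (b := v)]
        · simp
        · intro w hw
          rw [uIcc_of_le hpv] at hw
          simp [hpz w hw]
      have e2 : ∫ w in m..p, b w * g w ≤ ∫ w in m..p, b w * g m := by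
        refine intervalIntegral.integral_mono_on hm.2 (hii hbg hm0 hpm)
          ((hii hb hm0 hpm).mul_const _) fun w hw => ?_
        exact mul_le_mul_of_nonneg_left (hmax ⟨hm.1.trans hw.1, hw.2⟩) (hb0 w)
      have e3 : ∫ w in m..p, b w ≤ 1 / 2 := by
        have h1 := hδ' p hpm m hm0 (by
          rw [Real.dist_eq, abs_of_nonneg (by linarith [hm.2])]
          linarith [hm.1])
        have h2 := intervalIntegral.integral_add_adjacent_intervals
          (hii hb ⟨le_rfl, hv⟩ hm0) (hii hb hm0 hpm)
        rw [Real.dist_eq] at h1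
        have := (abs_lt.1 h1).2
        linarith
      -- At the maximum point `m` of `g` on `[u,p]` the inequality becomes `g m ≤ g m / 2`.
      have e4 : g m = 0 := by
        have h1 := h m hm0
        rw [e1] at h1
        rw [intervalIntegral.integral_mul_const] at e2
        have h2 := mul_le_mul_of_nonneg_right e3 (hg0 m hm0)
        linarith [hg0 m hm0]
      exact le_antisymm (by rw [← e4]; exact hmax ⟨le_rfl, hup⟩) (hg0 u hu)
  obtain ⟨n, hn⟩ := exists_nat_ge (v / (δ / 2))
  refine step n u0 hu0 ?_
  rw [div_le_iff₀ (by positivity)] at hn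
  linarith [hu0.1]

end Volterra

/-! ### Invertibility of the fundamental matrix -/

section Fundamental

variable {d d' mS mT : ℕ} {D : Data d d' mS mT} {Φ : ℝ → Matrix (Fin d) (Fin d) ℝ}

theorem Data.IsAdmissible.T_pos (hD : D.IsAdmissible) : 0 < D.T := hD.S_pos.trans hD.S_lt_T

theorem IntegrableOn.intervalIntegrable_of_mem {f : ℝ → ℝ} {s t : ℝ} (hf : IntegrableOn f (Icc s t))
    {p q : ℝ} (hp : p ∈ Icc s t) (hq : q ∈ Icc s t) : IntervalIntegrable f volume p q :=
  (hf.mono_set (uIcc_subset_Icc hp hq)).intervalIntegrable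

theorem Data.IsFundamental.continuousOn_entry (hΦ : D.IsFundamental Φ) (i j : Fin d) :
    ContinuousOn (fun u => Φ u i j) (Icc 0 D.T) :=
  (continuous_apply_apply i j).comp_continuousOn hΦ.1

theorem Data.IsFundamental.integrableOn_mul (hD : D.IsAdmissible) (hΦ : D.IsFundamental Φ)
    (i j : Fin d) : IntegrableOn (fun u => (D.B u * Φ u) i j) (Icc 0 D.T) := by
  simp only [Matrix.mul_apply]
  exact integrable_finsetSum _ fun k _ =>
    (hD.integrable_B i k).mul_continuousOn (hΦ.continuousOn_entry k j) isCompact_Icc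

theorem Data.IsFundamental.sub_eq_integral (hD : D.IsAdmissible) (hΦ : D.IsFundamental Φ)
    {v w : ℝ} (hv : v ∈ Icc 0 D.T) (hw : w ∈ Icc 0 D.T) (i j : Fin d) :
    Φ w i j - Φ v i j = ∫ u in v..w, (D.B u * Φ u) i j := by
  rw [hΦ.2 w hw, hΦ.2 v hv, add_sub_add_left_eq_sub]
  exact intervalIntegral.integral_interval_sub_left
    (IntegrableOn.intervalIntegrable_of_mem (hΦ.integrableOn_mul hD i j) ⟨le_rfl, hD.T_pos.le⟩ hw)
    (IntegrableOn.intervalIntegrable_of_mem (hΦ.integrableOn_mul hD i j) ⟨le_rfl, hD.T_pos.le⟩ hv)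

theorem Data.IsFundamental.sub_mulVec_eq_integral (hD : D.IsAdmissible) (hΦ : D.IsFundamental Φ)
    {v w : ℝ} (hv : v ∈ Icc 0 D.T) (hw : w ∈ Icc 0 D.T) (y : Fin d → ℝ) (i : Fin d) :
    ((Φ w - Φ v) *ᵥ y) i = ∫ u in v..w, (D.B u *ᵥ (Φ u *ᵥ y)) i := by
  simp only [mulVec_mulVec]
  simp only [mulVec, dotProduct, Matrix.sub_apply]
  rw [intervalIntegral.integral_finsetSum fun j _ => (IntegrableOn.intervalIntegrable_of_mem
    (hΦ.integrableOn_mul hD i j) hv hw).mul_const _]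
  exact Finset.sum_congr rfl fun j _ => by
    rw [hΦ.sub_eq_integral hD hv hw, intervalIntegral.integral_mul_const]

/-- If `Φ(v)c = 0`, the integral equation read backwards from `v` bounds `‖Φ(u)c‖` by an integral of
itself with weight the sum of the `|B i j|`. Gronwall then gives `Φ(0)c = 0`, that is, `c = 0`. -/
theorem Data.IsFundamental.isUnit_det (hD : D.IsAdmissible) (hΦ : D.IsFundamental Φ)
    {v : ℝ} (hv : v ∈ Icc 0 D.T) : IsUnit (Φ v).det := by
  rw [isUnit_iff_ne_zero]
  intro hdet
  obtain ⟨c, hc, hcv⟩ := Matrix.exists_mulVec_eq_zero_iff.2 hdet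
  have hsub : Icc 0 v ⊆ Icc 0 D.T := Icc_subset_Icc le_rfl hv.2
  have hcont : ContinuousOn (fun u => Φ u *ᵥ c) (Icc 0 v) :=
    (continuous_id.matrix_mulVec (continuous_const (y := c))).comp_continuousOn (hΦ.1.mono hsub)
  set b : ℝ → ℝ := fun u => ∑ i, ∑ j, |D.B u i j| with hb
  have hbint : IntegrableOn b (Icc 0 v) := integrable_finsetSum _ fun i _ =>
    integrable_finsetSum _ fun j _ => ((hD.integrable_B i j).mono_set hsub).abs
  have hbound : ∀ u i, |(D.B u *ᵥ (Φ u *ᵥ c)) i| ≤ b u * ‖Φ u *ᵥ c‖ := by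
    intro u i
    calc |(D.B u *ᵥ (Φ u *ᵥ c)) i| ≤ ∑ j, |D.B u i j * (Φ u *ᵥ c) j| :=
          Finset.abs_sum_le_sum_abs (fun j => D.B u i j * (Φ u *ᵥ c) j) Finset.univ
      _ ≤ ∑ j, |D.B u i j| * ‖Φ u *ᵥ c‖ := Finset.sum_le_sum fun j _ => by
          rw [abs_mul]
          exact mul_le_mul_of_nonneg_left (norm_le_pi_norm (Φ u *ᵥ c) j) (abs_nonneg _)
      _ = (∑ j, |D.B u i j|) * ‖Φ u *ᵥ c‖ := by rw [Finset.sum_mul]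
      _ ≤ b u * ‖Φ u *ᵥ c‖ := mul_le_mul_of_nonneg_right
          (Finset.single_le_sum (f := fun i => ∑ j, |D.B u i j|)
            (fun i _ => Finset.sum_nonneg fun j _ => abs_nonneg _) (Finset.mem_univ i))
          (norm_nonneg _)
  have hbn : IntegrableOn (fun u => b u * ‖Φ u *ᵥ c‖) (Icc 0 v) :=
    hbint.mul_continuousOn hcont.norm isCompact_Icc
  have hz := eq_zero_of_le_integral_mul hcont.norm (fun _ _ => norm_nonneg _)
    (fun u => Finset.sum_nonneg fun i _ => Finset.sum_nonneg fun j _ => abs_nonneg _) hbint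
    (fun u hu => by
      have hi := IntegrableOn.intervalIntegrable_of_mem hbn hu ⟨hv.1, le_rfl⟩
      have h0 : 0 ≤ ∫ w in u..v, b w * ‖Φ w *ᵥ c‖ :=
        intervalIntegral.integral_nonneg hu.2 fun w _ => mul_nonneg
          (Finset.sum_nonneg fun i _ => Finset.sum_nonneg fun j _ => abs_nonneg _) (norm_nonneg _)
      refine (pi_norm_le_iff_of_nonneg h0).2 fun i => ?_
      have h1 := hΦ.sub_mulVec_eq_integral hD (hsub hu) hv c i
      rw [sub_mulVec, hcv, zero_sub, Pi.neg_apply] at h1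
      rw [Real.norm_eq_abs, ← abs_neg, h1, ← Real.norm_eq_abs]
      exact intervalIntegral.norm_integral_le_of_norm_le hu.2
        (ae_of_all _ fun w _ => hbound w i) hi)
    0 ⟨le_rfl, hv.1⟩
  have h0 : Φ 0 = 1 := by
    ext i j
    rw [hΦ.2 0 ⟨le_rfl, hD.T_pos.le⟩, intervalIntegral.integral_same, add_zero]
  rw [h0, one_mulVec, norm_eq_zero] at hz
  exact hc hz

theorem Data.IsFundamental.continuousOn_inv (hD : D.IsAdmissible) (hΦ : D.IsFundamental Φ) :
    ContinuousOn (fun u => (Φ u)⁻¹) (Icc 0 D.T) := by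
  simp only [Matrix.inv_def, Ring.inverse_eq_inv']
  refine ContinuousOn.smul (ContinuousOn.inv₀ ?_ fun u hu => (hΦ.isUnit_det hD hu).ne_zero) ?_
  · exact (continuous_id.matrix_det).comp_continuousOn hΦ.1
  · exact (continuous_id.matrix_adjugate).comp_continuousOn hΦ.1

end Fundamental

/-! ### Riemann sums along uniform partitions -/

section Riemann

/-- The `k`-th point of the partition of `[s,t]` into `n + 1` intervals of equal length. -/
noncomputable def grid (s t : ℝ) (n k : ℕ) : ℝ := s + k * ((t - s) / (n + 1))

variable {s t : ℝ}

theorem grid_zero (n : ℕ) : grid s t n 0 = s := by simp [grid]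

theorem grid_last (n : ℕ) : grid s t n (n + 1) = t := by
  simp only [grid]
  push_cast
  field_simp
  ring

theorem monotone_grid (hst : s ≤ t) (n : ℕ) : Monotone (grid s t n) := by
  intro k l hkl
  have : 0 ≤ (t - s) / (n + 1) := div_nonneg (sub_nonneg.2 hst) (by positivity)
  have hkl' : (k : ℝ) ≤ l := by exact_mod_cast hkl
  simp only [grid]
  nlinarith

theorem grid_mem (hst : s ≤ t) {n k : ℕ} (hk : k ≤ n + 1) : grid s t n k ∈ Icc s t := by
  constructor
  · simpa [grid_zero] using monotone_grid hst n (Nat.zero_le k)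
  · simpa [grid_last] using monotone_grid hst n hk

theorem exists_mem_Ioc_grid (hst : s ≤ t) (n : ℕ) {u : ℝ} (hu : u ∈ Ioc s t) :
    ∃ k ∈ Finset.range (n + 1), u ∈ Ioc (grid s t n k) (grid s t n (k + 1)) ∧
      ∀ l, l ≠ k → u ∉ Ioc (grid s t n l) (grid s t n (l + 1)) := by
  have h := (monotone_grid hst n).biUnion_Ico_Ioc_map_succ 0 (n + 1)
  rw [grid_zero, grid_last] at h
  rw [← h] at hu
  simp only [mem_iUnion] at hu
  obtain ⟨k, hk, hu⟩ := hu
  refine ⟨k, Finset.mem_range.2 hk.2, hu, fun l hl hul => ?_⟩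
  exact Set.disjoint_left.1 ((monotone_grid hst n).pairwise_disjoint_on_Ioc_succ hl) hul hu

theorem grid_succ_sub (n k : ℕ) : grid s t n (k + 1) - grid s t n k = (t - s) / (n + 1) := by
  simp only [grid]
  push_cast
  ring

theorem tendsto_mesh : Tendsto (fun n : ℕ => (t - s) / ((n : ℝ) + 1)) atTop (𝓝 0) :=
  tendsto_const_nhds.div_atTop (tendsto_atTop_add_const_right _ _ tendsto_natCast_atTop_atTop)

/-- Riemann sums in which the coefficient also depends on the two ends of each interval. -/
theorem tendsto_sum_integral_grid (hst : s ≤ t) {A : ℝ × ℝ × ℝ → ℝ}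
    (hA : ContinuousOn A (Icc s t ×ˢ Icc s t ×ˢ Icc s t)) {f : ℝ → ℝ}
    (hf : IntegrableOn f (Icc s t)) :
    Tendsto (fun n => ∑ k ∈ Finset.range (n + 1), ∫ u in grid s t n k..grid s t n (k + 1),
      A (grid s t n k, grid s t n (k + 1), u) * f u) atTop (𝓝 (∫ u in s..t, A (u, u, u) * f u)) := by
  obtain ⟨C, hC⟩ := (isCompact_Icc.prod (isCompact_Icc.prod isCompact_Icc)).exists_bound_of_continuousOn hA
  have hf' : IntegrableOn f (Ioc s t) := hf.mono_set Ioc_subset_Icc_self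
  set F : ℕ → ℝ → ℝ := fun n u => ∑ k ∈ Finset.range (n + 1),
    (Ioc (grid s t n k) (grid s t n (k + 1))).indicator
      (fun u => A (grid s t n k, grid s t n (k + 1), u) * f u) u with hF
  have hsub : ∀ n, ∀ k ∈ Finset.range (n + 1),
      Ioc (grid s t n k) (grid s t n (k + 1)) ⊆ Ioc s t := fun n k hk => by
    have hk' := Finset.mem_range.1 hk
    exact Ioc_subset_Ioc (grid_mem hst hk'.le).1 (grid_mem hst (Nat.succ_le_of_lt hk')).2
  have hint : ∀ n, ∀ k ∈ Finset.range (n + 1), IntegrableOn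
      (fun u => A (grid s t n k, grid s t n (k + 1), u) * f u) (Ioc s t) := by
    intro n k hk
    have hk' := Finset.mem_range.1 hk
    have hc : ContinuousOn (fun u => A (grid s t n k, grid s t n (k + 1), u)) (Icc s t) :=
      hA.comp (by fun_prop) fun u hu =>
        ⟨grid_mem hst hk'.le, grid_mem hst (Nat.succ_le_of_lt hk'), hu⟩
    exact (hf.continuousOn_mul hc isCompact_Icc).mono_set Ioc_subset_Icc_self
  have hsum : ∀ n, ∑ k ∈ Finset.range (n + 1), ∫ u in grid s t n k..grid s t n (k + 1),
      A (grid s t n k, grid s t n (k + 1), u) * f u = ∫ u in Ioc s t, F n u := by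
    intro n
    rw [hF, integral_finsetSum _ fun k hk => (hint n k hk).indicator measurableSet_Ioc]
    refine Finset.sum_congr rfl fun k hk => ?_
    rw [intervalIntegral.integral_of_le (monotone_grid hst n (Nat.le_succ k)),
      setIntegral_indicator measurableSet_Ioc, inter_eq_self_of_subset_right (hsub n k hk)]
  -- A point lies in exactly one cell, so the sum collapses to one term, and both ends `v`, `w` of
  -- the cell tend to `u`. With `C * |f u|` as a bound this allows dominated convergence.
  have hval : ∀ n : ℕ, ∀ u ∈ Ioc s t, ∃ v ∈ Icc s t, ∃ w ∈ Icc s t, |v - u| ≤ (t - s) / (n + 1) ∧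
      |w - u| ≤ (t - s) / (n + 1) ∧ F n u = A (v, w, u) * f u := by
    intro n u hu
    obtain ⟨k, hk, huk, hne⟩ := exists_mem_Ioc_grid hst n hu
    have hk' := Finset.mem_range.1 hk
    have hd := grid_succ_sub (s := s) (t := t) n k
    refine ⟨_, grid_mem hst hk'.le, _, grid_mem hst (Nat.succ_le_of_lt hk'), ?_, ?_, ?_⟩
    · rw [abs_sub_comm, abs_of_nonneg (by linarith [huk.1])]
      linarith [huk.2]
    · rw [abs_of_nonneg (by linarith [huk.2])]
      linarith [huk.1]
    · simp only [hF]
      rw [Finset.sum_eq_single_of_mem k hk fun l _ hl => indicator_of_notMem (hne l hl) _,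
        indicator_of_mem huk]
  simp only [hsum]
  rw [intervalIntegral.integral_of_le hst]
  refine tendsto_integral_of_dominated_convergence (fun u => C * |f u|) (fun n => ?_)
    (hf'.abs.const_mul C) (fun n => ?_) ?_
  · exact (integrable_finsetSum _ fun k hk => (hint n k hk).indicator measurableSet_Ioc).1
  · refine (ae_restrict_iff' measurableSet_Ioc).2 (ae_of_all _ fun u hu => ?_)
    obtain ⟨v, hv, w, hw, -, -, h⟩ := hval n u hu
    rw [h, norm_mul, Real.norm_eq_abs (f u)]
    exact mul_le_mul_of_nonneg_right (hC _ ⟨hv, hw, Ioc_subset_Icc_self hu⟩) (abs_nonneg _)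
  · refine (ae_restrict_iff' measurableSet_Ioc).2 (ae_of_all _ fun u hu => ?_)
    have hu' := Ioc_subset_Icc_self hu
    choose v hv w hw h1 h2 h3 using fun n => hval n u hu
    simp only [h3]
    have tv : Tendsto v atTop (𝓝 u) := tendsto_iff_dist_tendsto_zero.2
      (squeeze_zero (fun _ => dist_nonneg) (fun n => h1 n) tendsto_mesh)
    have tw : Tendsto w atTop (𝓝 u) := tendsto_iff_dist_tendsto_zero.2
      (squeeze_zero (fun _ => dist_nonneg) (fun n => h2 n) tendsto_mesh)
    refine Tendsto.mul_const _ ((hA (u, u, u) ⟨hu', hu', hu'⟩).tendsto.comp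
      (tendsto_nhdsWithin_iff.2 ⟨tv.prodMk_nhds (tw.prodMk_nhds tendsto_const_nhds),
        Eventually.of_forall fun n => ⟨hv n, hw n, hu'⟩⟩))

end Riemann

/-! ### Entrywise integrals of matrices -/

section MatIntegral

variable {m n k l : Type*} [Fintype m] [Fintype n]

theorem dotProduct_matIntegral_mulVec {F : ℝ → Matrix m n ℝ} {s t : ℝ}
    (hF : ∀ i j, IntervalIntegrable (fun u => F u i j) volume s t) (x : m → ℝ) (y : n → ℝ) :
    x ⬝ᵥ (matIntegral F s t *ᵥ y) = ∫ u in s..t, x ⬝ᵥ (F u *ᵥ y) := by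
  simp only [dotProduct, mulVec, matIntegral, of_apply, Finset.mul_sum]
  rw [intervalIntegral.integral_finsetSum fun i _ => by
    simpa only [Finset.sum_fn] using IntervalIntegrable.sum (f := fun j u => x i * (F u i j * y j))
      Finset.univ fun j _ => ((hF i j).mul_const _).const_mul _]
  refine Finset.sum_congr rfl fun i _ => ?_
  rw [intervalIntegral.integral_finsetSum fun j _ => ((hF i j).mul_const _).const_mul _]
  refine Finset.sum_congr rfl fun j _ => ?_
  rw [intervalIntegral.integral_const_mul, intervalIntegral.integral_mul_const]

theorem mul_matIntegral_mul {F : ℝ → Matrix m n ℝ} {s t : ℝ}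
    (hF : ∀ i j, IntervalIntegrable (fun u => F u i j) volume s t) (A : Matrix k m ℝ)
    (B : Matrix n l ℝ) : A * matIntegral F s t * B = matIntegral (fun u => A * F u * B) s t := by
  ext p q
  have h : ∀ G : Matrix m n ℝ, (A * G * B) p q = A p ⬝ᵥ (G *ᵥ (fun j => B j q)) := fun G => by
    rw [Matrix.mul_assoc]; rfl
  simp only [matIntegral, of_apply, h]
  exact dotProduct_matIntegral_mulVec hF _ _

theorem posSemidef_matIntegral {F : ℝ → Matrix m m ℝ} {s t : ℝ} (hst : s ≤ t)
    (hF : ∀ i j, IntervalIntegrable (fun u => F u i j) volume s t) (hp : ∀ u, (F u).PosSemidef) :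
    (matIntegral F s t).PosSemidef := by
  refine PosSemidef.of_dotProduct_mulVec_nonneg ?_ fun x => ?_
  · ext i j
    simp only [matIntegral, conjTranspose_apply, of_apply, star_trivial]
    exact intervalIntegral.integral_congr fun u _ => by simpa using (hp u).isHermitian.apply i j
  · rw [star_trivial, dotProduct_matIntegral_mulVec hF]
    exact intervalIntegral.integral_nonneg hst fun u _ => by
      simpa using (hp u).dotProduct_mulVec_nonneg x

end MatIntegral

/-! ### Variation of constants along a single path -/

section Pathwise

variable {d d' mS mT : ℕ} {D : Data d d' mS mT} {Φ : ℝ → Matrix (Fin d) (Fin d) ℝ}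

theorem Data.IsFundamental.flow_self (hD : D.IsAdmissible) (hΦ : D.IsFundamental Φ) {t : ℝ}
    (ht : t ∈ Icc 0 D.T) : flow Φ t t = 1 :=
  mul_nonsing_inv _ (hΦ.isUnit_det hD ht)

theorem Data.IsFundamental.flow_mul_flow (hD : D.IsAdmissible) (hΦ : D.IsFundamental Φ) {s : ℝ}
    (hs : s ∈ Icc 0 D.T) (t u : ℝ) : flow Φ t s * flow Φ s u = flow Φ t u := by
  rw [flow, flow, flow, Matrix.mul_assoc, ← Matrix.mul_assoc (Φ s)⁻¹,
    nonsing_inv_mul _ (hΦ.isUnit_det hD hs), Matrix.one_mul]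

theorem Data.IsFundamental.continuousOn_flow (hD : D.IsAdmissible) (hΦ : D.IsFundamental Φ)
    (t : ℝ) : ContinuousOn (fun u => flow Φ t u) (Icc 0 D.T) :=
  (continuous_const.matrix_mul continuous_id).comp_continuousOn (hΦ.continuousOn_inv hD)

theorem Data.IsFundamental.continuousOn_flow_entry (hD : D.IsAdmissible) (hΦ : D.IsFundamental Φ)
    (t : ℝ) (i j : Fin d) : ContinuousOn (fun u => flow Φ t u i j) (Icc 0 D.T) :=
  (continuous_apply_apply i j).comp_continuousOn (hΦ.continuousOn_flow hD t)

theorem Data.IsFundamental.continuousOn_vecMul_flow (hD : D.IsAdmissible) (hΦ : D.IsFundamental Φ)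
    (θ : Fin d → ℝ) (t : ℝ) (i : Fin d) :
    ContinuousOn (fun u => (θ ᵥ* flow Φ t u) i) (Icc 0 D.T) :=
  (continuous_apply i).comp_continuousOn
    ((continuous_const.matrix_vecMul continuous_id).comp_continuousOn (hΦ.continuousOn_flow hD t))

/-- `x(p) - x(s) - ∫ₛᵖ (β + B x) du`, the martingale part of a solution `x`. -/
noncomputable def Data.martPart (D : Data d d' mS mT) (s : ℝ) (x : ℝ → Fin d → ℝ) (p : ℝ) :
    Fin d → ℝ :=
  fun i => x p i - x s i - ∫ u in s..p, (D.β u i + (D.B u *ᵥ x u) i)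

theorem Data.IsAdmissible.integrableOn_drift (hD : D.IsAdmissible) {s t : ℝ} (hs : 0 ≤ s)
    (ht : t ≤ D.T) {x : ℝ → Fin d → ℝ} (hx : ContinuousOn x (Icc s t)) (i j : Fin d) :
    IntegrableOn (fun u => x u j * D.B u i j) (Icc s t) :=
  ((hD.integrable_B i j).mono_set (Icc_subset_Icc hs ht)).continuousOn_mul
    ((continuous_apply j).comp_continuousOn hx) isCompact_Icc

theorem Data.IsAdmissible.martPart_sub (hD : D.IsAdmissible) {s t : ℝ} (hs : 0 ≤ s)
    (ht : t ≤ D.T) {x : ℝ → Fin d → ℝ} (hx : ContinuousOn x (Icc s t)) {v w : ℝ}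
    (hv : v ∈ Icc s t) (hw : w ∈ Icc s t) (i : Fin d) :
    D.martPart s x w i - D.martPart s x v i = x w i - x v i - (∫ u in v..w, D.β u i) -
      ∑ j, ∫ u in v..w, x u j * D.B u i j := by
  have hβ := (hD.integrable_β i).mono_set (Icc_subset_Icc hs ht)
  have hB := fun j => hD.integrableOn_drift hs ht hx i j
  have hss : s ∈ Icc s t := ⟨le_rfl, hv.1.trans hv.2⟩
  have hBs : IntegrableOn (fun u => ∑ j, x u j * D.B u i j) (Icc s t) :=
    integrable_finsetSum _ fun j _ => hB j
  have e : ∀ u, D.β u i + (D.B u *ᵥ x u) i = D.β u i + ∑ j, x u j * D.B u i j := fun u => by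
    simp only [mulVec, dotProduct, mul_comm]
  have hI := hβ.add hBs
  have h1 := intervalIntegral.integral_interval_sub_left
    (IntegrableOn.intervalIntegrable_of_mem hI hss hw)
    (IntegrableOn.intervalIntegrable_of_mem hI hss hv)
  simp only [Pi.add_apply] at h1
  rw [intervalIntegral.integral_add (IntegrableOn.intervalIntegrable_of_mem hβ hv hw)
    (IntegrableOn.intervalIntegrable_of_mem hBs hv hw),
    intervalIntegral.integral_finsetSum fun j _ =>
      IntegrableOn.intervalIntegrable_of_mem (hB j) hv hw] at h1
  simp only [martPart, e]
  linarith

/-- The equation `c' = -cB` for the row `c(u) = θ'Φ(t,u)`, in integrated form. The vector `z` is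
carried from `v` to `w` by the equation for `Φ`, so `Φ⁻¹` is never differentiated, and `c` stays
frozen at the right end `w`. -/
theorem Data.IsFundamental.vecMul_flow_dotProduct (hD : D.IsAdmissible) (hΦ : D.IsFundamental Φ)
    (θ : Fin d → ℝ) {t v w : ℝ} (hv : v ∈ Icc 0 D.T) (hw : w ∈ Icc 0 D.T) (z : Fin d → ℝ) :
    (θ ᵥ* flow Φ t v) ⬝ᵥ z = (θ ᵥ* flow Φ t w) ⬝ᵥ z +
      ∑ i, ∑ j, (θ ᵥ* flow Φ t w) i *
        ∫ u in v..w, (Φ u *ᵥ ((Φ v)⁻¹ *ᵥ z)) j * D.B u i j := by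
  have h1 : ∀ i, ∑ j, ∫ u in v..w, (Φ u *ᵥ ((Φ v)⁻¹ *ᵥ z)) j * D.B u i j =
      ((Φ w - Φ v) *ᵥ ((Φ v)⁻¹ *ᵥ z)) i := by
    intro i
    rw [hΦ.sub_mulVec_eq_integral hD hv hw, ← intervalIntegral.integral_finsetSum]
    · simp only [mulVec, dotProduct, mul_comm]
    · intro j _
      refine IntegrableOn.intervalIntegrable_of_mem ?_ hv hw
      exact (hD.integrable_B i j).continuousOn_mul ((continuous_apply j).comp_continuousOn
        ((continuous_id.matrix_mulVec continuous_const).comp_continuousOn hΦ.1)) isCompact_Icc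
  simp only [← Finset.mul_sum, h1]
  change _ = _ + (θ ᵥ* flow Φ t w) ⬝ᵥ ((Φ w - Φ v) *ᵥ ((Φ v)⁻¹ *ᵥ z))
  rw [sub_mulVec, dotProduct_sub, mulVec_mulVec, mulVec_mulVec,
    mul_nonsing_inv _ (hΦ.isUnit_det hD hv), one_mulVec, add_sub_cancel, dotProduct_mulVec,
    vecMul_vecMul]
  congr 2
  exact (hΦ.flow_mul_flow hD hw t v).symm

/-- Along the partitions of `[s,t]` the Riemann–Stieltjes sums of `θ' Φ(t,·)` against the
martingale part converge, for every continuous path. -/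
theorem tendsto_sum_flow_mul_martPart (hD : D.IsAdmissible) (hΦ : D.IsFundamental Φ) {s t : ℝ}
    (hs : 0 ≤ s) (hst : s ≤ t) (ht : t ≤ D.T) (θ : Fin d → ℝ) {x : ℝ → Fin d → ℝ}
    (hx : ContinuousOn x (Icc s t)) :
    Tendsto (fun n => ∑ k ∈ Finset.range (n + 1), ∑ i, (θ ᵥ* flow Φ t (grid s t n (k + 1))) i *
        (D.martPart s x (grid s t n (k + 1)) i - D.martPart s x (grid s t n k) i)) atTop
      (𝓝 (θ ⬝ᵥ x t - (θ ᵥ* flow Φ t s) ⬝ᵥ x s -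
        ∑ i, ∫ u in s..t, (θ ᵥ* flow Φ t u) i * D.β u i)) := by
  have hsub : Icc s t ⊆ Icc 0 D.T := Icc_subset_Icc hs ht
  set c : ℝ → Fin d → ℝ := fun u => θ ᵥ* flow Φ t u with hc
  have hcc : ∀ i, ContinuousOn (fun u => c u i) (Icc s t) := fun i =>
    (hΦ.continuousOn_vecMul_flow hD θ t i).mono hsub
  have hxx : ∀ j, ContinuousOn (fun u => x u j) (Icc s t) := fun j =>
    (continuous_apply j).comp_continuousOn hx
  have hy : ContinuousOn (fun v => (Φ v)⁻¹ *ᵥ x v) (Icc s t) :=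
    (continuous_fst.matrix_mulVec continuous_snd).comp_continuousOn
      (((hΦ.continuousOn_inv hD).mono hsub).prodMk hx)
  have h1 : ∀ {E : Type} [TopologicalSpace E] {g : ℝ → E}, ContinuousOn g (Icc s t) →
      ContinuousOn (fun q : ℝ × ℝ × ℝ => g q.1) (Icc s t ×ˢ Icc s t ×ˢ Icc s t) := fun h =>
    h.comp (by fun_prop) fun q hq => hq.1
  have h2 : ∀ {E : Type} [TopologicalSpace E] {g : ℝ → E}, ContinuousOn g (Icc s t) →
      ContinuousOn (fun q : ℝ × ℝ × ℝ => g q.2.1) (Icc s t ×ˢ Icc s t ×ˢ Icc s t) := fun h =>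
    h.comp (by fun_prop) fun q hq => hq.2.1
  have h3 : ∀ {E : Type} [TopologicalSpace E] {g : ℝ → E}, ContinuousOn g (Icc s t) →
      ContinuousOn (fun q : ℝ × ℝ × ℝ => g q.2.2) (Icc s t ×ˢ Icc s t ×ˢ Icc s t) := fun h =>
    h.comp (by fun_prop) fun q hq => hq.2.2
  have l1 := tendsto_finsetSum Finset.univ fun i _ =>
    tendsto_sum_integral_grid hst (h2 (hcc i)) ((hD.integrable_β i).mono_set hsub)
  have l2 := tendsto_finsetSum Finset.univ fun i _ => tendsto_finsetSum Finset.univ fun j _ =>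
    tendsto_sum_integral_grid hst ((h2 (hcc i)).mul (h3 (hxx j)))
      ((hD.integrable_B i j).mono_set hsub)
  have hyy : ∀ j, ContinuousOn (fun q : ℝ × ℝ × ℝ => (Φ q.2.2 *ᵥ ((Φ q.1)⁻¹ *ᵥ x q.1)) j)
      (Icc s t ×ˢ Icc s t ×ˢ Icc s t) := fun j =>
    (continuous_apply j).comp_continuousOn
      ((continuous_fst.matrix_mulVec continuous_snd).comp_continuousOn
        ((h3 (hΦ.1.mono hsub)).prodMk (h1 hy)))
  have l3 := tendsto_finsetSum Finset.univ fun i _ => tendsto_finsetSum Finset.univ fun j _ =>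
    tendsto_sum_integral_grid hst ((h2 (hcc i)).mul (hyy j))
      ((hD.integrable_B i j).mono_set hsub)
  -- On the diagonal `Φ(u)Φ(u)⁻¹` cancels, so the limits in `l2` (drift along the path) and `l3`
  -- (drift along the homogeneous flow started at the left end of each cell) coincide and drop out.
  have e3 : ∑ i, ∑ j, ∫ u in s..t, c u i * (Φ u *ᵥ ((Φ u)⁻¹ *ᵥ x u)) j * D.B u i j =
      ∑ i, ∑ j, ∫ u in s..t, c u i * x u j * D.B u i j := by
    refine Finset.sum_congr rfl fun i _ => Finset.sum_congr rfl fun j _ =>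
      intervalIntegral.integral_congr fun u hu => ?_
    rw [uIcc_of_le hst] at hu
    simp only [mulVec_mulVec, mul_nonsing_inv _ (hΦ.isUnit_det hD (hsub hu)), one_mulVec]
  have l := ((tendsto_const_nhds (x := c t ⬝ᵥ x t - c s ⬝ᵥ x s)).sub l1).sub (l2.sub l3)
  have htt : t ∈ Icc 0 D.T := ⟨hs.trans hst, ht⟩
  simp only [Pi.mul_apply, e3, sub_self, sub_zero] at l
  have hct : c t = θ := by rw [hc]; simp only [hΦ.flow_self hD htt, vecMul_one]
  rw [hct] at l
  refine l.congr fun n => ?_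
  -- The boundary terms of the limit are the telescoped increments of `c ⬝ᵥ x`; the rest of the
  -- identity is checked cell by cell.
  have tel := Finset.sum_range_sub (fun k => c (grid s t n k) ⬝ᵥ x (grid s t n k)) (n + 1)
  rw [grid_last, grid_zero, hct] at tel
  rw [← tel]
  simp only [Finset.sum_comm (s := Finset.univ (α := Fin d)) (t := Finset.range (n + 1))]
  rw [← Finset.sum_sub_distrib, ← Finset.sum_sub_distrib, ← Finset.sum_sub_distrib]
  refine Finset.sum_congr rfl fun k hk => ?_
  have hk' := Finset.mem_range.1 hk
  have hv : grid s t n k ∈ Icc s t := grid_mem hst hk'.le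
  have hw : grid s t n (k + 1) ∈ Icc s t := grid_mem hst (Nat.succ_le_of_lt hk')
  have hst' := hΦ.vecMul_flow_dotProduct hD θ (t := t) (hsub hv) (hsub hw) (x (grid s t n k))
  change c _ ⬝ᵥ _ = c _ ⬝ᵥ _ + ∑ i, ∑ j, c _ i * _ at hst'
  rw [hst']
  simp only [hD.martPart_sub hs ht hx hv hw, mul_assoc, intervalIntegral.integral_const_mul,
    mul_sub, Finset.sum_sub_distrib, Finset.mul_sum, dotProduct]
  ring

end Pathwise

/-! ### Normality of the transition law -/

section Transition

variable {d d' mS mT : ℕ} {D : Data d d' mS mT} {Φ : ℝ → Matrix (Fin d) (Fin d) ℝ}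

theorem Data.IsAdmissible.integrableOn_σ_mul_σ (hD : D.IsAdmissible) (i i' : Fin d) (j : Fin d') :
    IntegrableOn (fun u => D.σ u i j * D.σ u i' j) (Icc 0 D.T) :=
  (hD.memLp_σ i j).integrable_mul (hD.memLp_σ i' j)

theorem Data.IsAdmissible.integrableOn_a (hD : D.IsAdmissible) (i i' : Fin d) :
    IntegrableOn (fun u => D.a u i i') (Icc 0 D.T) := by
  simp only [Data.a, Matrix.mul_apply, transpose_apply]
  exact integrable_finsetSum _ fun j _ => hD.integrableOn_σ_mul_σ i i' j

theorem Data.posSemidef_a (D : Data d d' mS mT) (u : ℝ) : (D.a u).PosSemidef := by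
  rw [Data.a, ← conjTranspose_eq_transpose_of_trivial]
  exact posSemidef_self_mul_conjTranspose (D.σ u)

/-- The covariance matrix of the state at time `t` of the process started at time `s`. -/
noncomputable def Data.transCov (D : Data d d' mS mT) (Φ : ℝ → Matrix (Fin d) (Fin d) ℝ)
    (s t : ℝ) : Matrix (Fin d) (Fin d) ℝ :=
  matIntegral (fun u => flow Φ t u * D.a u * (flow Φ t u)ᵀ) s t

/-- The mean of the state at time `t` of the process started at time `s` in `x`. -/
noncomputable def Data.transMean (D : Data d d' mS mT) (Φ : ℝ → Matrix (Fin d) (Fin d) ℝ)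
    (s t : ℝ) (x : Fin d → ℝ) : Fin d → ℝ :=
  flow Φ t s *ᵥ x + fun i => ∫ u in s..t, (flow Φ t u *ᵥ D.β u) i

theorem Data.IsFundamental.integrableOn_flow_mul_a (hD : D.IsAdmissible) (hΦ : D.IsFundamental Φ)
    (t : ℝ) (i j : Fin d) :
    IntegrableOn (fun u => (flow Φ t u * D.a u * (flow Φ t u)ᵀ) i j) (Icc 0 D.T) := by
  simp only [Matrix.mul_apply, transpose_apply, Finset.sum_mul]
  refine integrable_finsetSum _ fun k _ => integrable_finsetSum _ fun l _ => ?_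
  exact ((hD.integrableOn_a l k).continuousOn_mul (hΦ.continuousOn_flow_entry hD t i l)
    isCompact_Icc).mul_continuousOn (hΦ.continuousOn_flow_entry hD t j k) isCompact_Icc

theorem Data.posSemidef_flow_mul_a (D : Data d d' mS mT) (t u : ℝ) :
    (flow Φ t u * D.a u * (flow Φ t u)ᵀ).PosSemidef := by
  simpa only [conjTranspose_eq_transpose_of_trivial] using
    (D.posSemidef_a u).mul_mul_conjTranspose_same (flow Φ t u)

theorem Data.IsFundamental.posSemidef_transCov (hD : D.IsAdmissible) (hΦ : D.IsFundamental Φ)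
    {s t : ℝ} (hs : 0 ≤ s) (hst : s ≤ t) (ht : t ≤ D.T) : (D.transCov Φ s t).PosSemidef :=
  posSemidef_matIntegral hst (fun i j => IntegrableOn.intervalIntegrable_of_mem
    (hΦ.integrableOn_flow_mul_a hD t i j) ⟨hs, hst.trans ht⟩ ⟨hs.trans hst, ht⟩)
    fun u => D.posSemidef_flow_mul_a t u

theorem Data.IsFundamental.dotProduct_transMean (hD : D.IsAdmissible) (hΦ : D.IsFundamental Φ)
    {s t : ℝ} (hs : s ∈ Icc 0 D.T) (ht : t ∈ Icc 0 D.T) (θ x : Fin d → ℝ) :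
    θ ⬝ᵥ D.transMean Φ s t x =
      (θ ᵥ* flow Φ t s) ⬝ᵥ x + ∑ i, ∫ u in s..t, (θ ᵥ* flow Φ t u) i * D.β u i := by
  rw [transMean, dotProduct_add, dotProduct_mulVec]
  congr 1
  have hint : ∀ k i, IntervalIntegrable (fun u => flow Φ t u k i * D.β u i) volume s t :=
    fun k i => IntegrableOn.intervalIntegrable_of_mem ((hD.integrable_β i).continuousOn_mul
      (hΦ.continuousOn_flow_entry hD t k i) isCompact_Icc) hs ht
  simp only [dotProduct, mulVec, vecMul, Finset.sum_mul]
  have e1 : ∀ k, ∫ u in s..t, ∑ i, flow Φ t u k i * D.β u i =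
      ∑ i, ∫ u in s..t, flow Φ t u k i * D.β u i := fun k =>
    intervalIntegral.integral_finsetSum fun i _ => hint k i
  have e2 : ∀ i, ∫ u in s..t, ∑ k, θ k * flow Φ t u k i * D.β u i =
      ∑ k, θ k * ∫ u in s..t, flow Φ t u k i * D.β u i := fun i => by
    simp only [mul_assoc]
    rw [intervalIntegral.integral_finsetSum fun k _ => (hint k i).const_mul _]
    exact Finset.sum_congr rfl fun k _ => intervalIntegral.integral_const_mul _ _
  simp only [e1, e2, Finset.mul_sum]
  exact Finset.sum_comm

/-- Splitting `a = σσ'` over the Brownian components gives the variance the shape in which the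
squared norms of the step kernels converge. -/
theorem Data.IsFundamental.dotProduct_transCov (hD : D.IsAdmissible) (hΦ : D.IsFundamental Φ)
    {s t : ℝ} (hs : s ∈ Icc 0 D.T) (ht : t ∈ Icc 0 D.T) (θ : Fin d → ℝ) :
    θ ⬝ᵥ (D.transCov Φ s t *ᵥ θ) = ∑ j, ∑ i, ∑ i', ∫ u in s..t,
      (θ ᵥ* flow Φ t u) i * (θ ᵥ* flow Φ t u) i' * (D.σ u i j * D.σ u i' j) := by
  have hint : ∀ i i' j, IntervalIntegrable (fun u =>
      (θ ᵥ* flow Φ t u) i * (θ ᵥ* flow Φ t u) i' * (D.σ u i j * D.σ u i' j)) volume s t :=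
    fun i i' j => IntegrableOn.intervalIntegrable_of_mem
      ((hD.integrableOn_σ_mul_σ i i' j).continuousOn_mul
        ((hΦ.continuousOn_vecMul_flow hD θ t i).mul (hΦ.continuousOn_vecMul_flow hD θ t i'))
        isCompact_Icc) hs ht
  have hsum : ∀ {ι : Type} (f : ι → ℝ → ℝ) (r : Finset ι),
      (∀ i ∈ r, IntervalIntegrable (f i) volume s t) →
      IntervalIntegrable (fun u => ∑ i ∈ r, f i u) volume s t := fun f r h => by
    simpa only [Finset.sum_fn] using IntervalIntegrable.sum r h
  rw [transCov, dotProduct_matIntegral_mulVec fun i j => IntegrableOn.intervalIntegrable_of_mem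
    (hΦ.integrableOn_flow_mul_a hD t i j) hs ht]
  have e : ∀ u, θ ⬝ᵥ ((flow Φ t u * D.a u * (flow Φ t u)ᵀ) *ᵥ θ) = ∑ j, ∑ i, ∑ i',
      (θ ᵥ* flow Φ t u) i * (θ ᵥ* flow Φ t u) i' * (D.σ u i j * D.σ u i' j) := by
    intro u
    rw [← mulVec_mulVec, ← mulVec_mulVec, mulVec_transpose, dotProduct_mulVec, Data.a,
      ← mulVec_mulVec, mulVec_transpose, dotProduct_mulVec]
    generalize θ ᵥ* flow Φ t u = c
    simp only [dotProduct, vecMul, Finset.sum_mul_sum]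
    refine Finset.sum_congr rfl fun j _ => Finset.sum_congr rfl fun i _ =>
      Finset.sum_congr rfl fun i' _ => ?_
    ring
  simp only [e]
  rw [intervalIntegral.integral_finsetSum fun j _ => hsum _ _ fun i _ => hsum _ _ fun i' _ =>
    hint i i' j]
  refine Finset.sum_congr rfl fun j _ => ?_
  rw [intervalIntegral.integral_finsetSum fun i _ => hsum _ _ fun i' _ => hint i i' j]
  refine Finset.sum_congr rfl fun i _ => ?_
  rw [intervalIntegral.integral_finsetSum fun i' _ => hint i i' j]

variable {Ω : Type*} [MeasurableSpace Ω] {P : Measure Ω} [IsProbabilityMeasure P]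
  {W : Fin d' → ℝ≥0 → Ω → ℝ}

/-- By the equation and the initial condition the martingale part is almost surely the sum of the
stochastic integrals, each with a kernel in a single component. Working with it instead of those
integrals gives one path-dependent object for all times. -/
theorem Data.IsSolution.martPart_mem_wienerPairs (hD : D.IsAdmissible) (hW : IsBrownianVector P W)
    {s : ℝ} (hs : 0 ≤ s) {x : Fin d → ℝ} {X : ℝ → Ω → Fin d → ℝ} (hX : D.IsSolution P W s x X)
    {p : ℝ} (hp : p ∈ Icc s D.T) (i : Fin d) :
    ((fun j => (Ioc s p).indicator fun u => D.σ u i j),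
      fun ω => D.martPart s (fun t => X t ω) p i) ∈ wienerPairs hW := by
  obtain ⟨J, hJ, hae⟩ := hX.equation p hp i
  have hsub : Ioc s p ⊆ Icc 0 D.T := fun u hu => ⟨hs.trans hu.1.le, hu.2.trans hp.2⟩
  have h1 : ∀ j, ((Pi.single j ((Ioc s p).indicator fun u => D.σ u i j), J j) :
      (Fin d' → ℝ → ℝ) × (Ω → ℝ)) ∈ wienerPairs hW := fun j =>
    (hJ j).mem_wienerPairs hW hs ((hD.memLp_σ i j).mono_measure (Measure.restrict_mono_set _ hsub))
  have h2 := sum_mem (t := Finset.univ) fun j _ => h1 j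
  have h3 : ∑ j, ((Pi.single j ((Ioc s p).indicator fun u => D.σ u i j), J j) :
      (Fin d' → ℝ → ℝ) × (Ω → ℝ)) =
      ((fun j => (Ioc s p).indicator fun u => D.σ u i j), fun ω => ∑ j, J j ω) := by
    refine Prod.ext ?_ ?_
    · rw [Prod.fst_sum]
      exact Finset.univ_sum_single _
    · rw [Prod.snd_sum]
      ext ω
      simp
  rw [h3] at h2
  refine congr_ae_mem_wienerPairs hW h2 ?_
  filter_upwards [hae, hX.initial] with ω h4 h5
  simp only [martPart]
  rw [h4, h5]
  ring

/-- The differences of indicators live on disjoint cells, so products from different cells vanish.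
-/
theorem integral_sq_sum_indicator_grid {s t : ℝ} (hst : s ≤ t) (n : ℕ) (c : ℕ → Fin d → ℝ)
    {f : Fin d → ℝ → ℝ} (hf : ∀ i i', IntegrableOn (fun u => f i u * f i' u) (Icc s t)) :
    ∫ u, (∑ k ∈ Finset.range (n + 1), ∑ i, c k i *
      ((Ioc s (grid s t n (k + 1))).indicator (f i) u - (Ioc s (grid s t n k)).indicator (f i) u)) ^ 2
    = ∑ k ∈ Finset.range (n + 1), ∑ i, ∑ i', ∫ u in grid s t n k..grid s t n (k + 1),
        c k i * c k i' * (f i u * f i' u) := by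
  have hmono := monotone_grid hst n
  have e0 : ∀ k i u, (Ioc s (grid s t n (k + 1))).indicator (f i) u -
      (Ioc s (grid s t n k)).indicator (f i) u =
      (Ioc (grid s t n k) (grid s t n (k + 1))).indicator (f i) u := by
    intro k i u
    have h1 := hmono (Nat.le_succ k)
    have h2 := hmono (Nat.zero_le k)
    rw [grid_zero] at h2
    simp only [Nat.succ_eq_add_one] at h1
    simp only [indicator_apply, mem_Ioc]
    split_ifs <;> grind
  have e1 : ∀ u, (∑ k ∈ Finset.range (n + 1), ∑ i, c k i *
      ((Ioc s (grid s t n (k + 1))).indicator (f i) u -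
        (Ioc s (grid s t n k)).indicator (f i) u)) ^ 2 =
      ∑ k ∈ Finset.range (n + 1), (Ioc (grid s t n k) (grid s t n (k + 1))).indicator
        (fun u => ∑ i, ∑ i', c k i * c k i' * (f i u * f i' u)) u := by
    intro u
    simp only [e0]
    by_cases hu : u ∈ Ioc s t
    · obtain ⟨k, hk, huk, hne⟩ := exists_mem_Ioc_grid hst n hu
      rw [Finset.sum_eq_single_of_mem k hk fun l _ hl => Finset.sum_eq_zero fun i _ => by
          rw [indicator_of_notMem (hne l hl), mul_zero],
        Finset.sum_eq_single_of_mem k hk fun l _ hl => indicator_of_notMem (hne l hl) _,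
        indicator_of_mem huk, sq, Finset.sum_mul_sum]
      simp only [indicator_of_mem huk]
      refine Finset.sum_congr rfl fun i _ => Finset.sum_congr rfl fun i' _ => ?_
      ring
    · have hn : ∀ k ∈ Finset.range (n + 1), u ∉ Ioc (grid s t n k) (grid s t n (k + 1)) :=
        fun k hk h => hu ⟨(grid_mem hst (Finset.mem_range.1 hk).le).1.trans_lt h.1,
          h.2.trans (grid_mem hst (Nat.succ_le_of_lt (Finset.mem_range.1 hk))).2⟩
      rw [Finset.sum_eq_zero fun k hk => Finset.sum_eq_zero fun i _ => by
          rw [indicator_of_notMem (hn k hk), mul_zero],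
        Finset.sum_eq_zero fun k hk => indicator_of_notMem (hn k hk) _]
      simp
  simp only [e1]
  have hi : ∀ k ∈ Finset.range (n + 1), ∀ i i', IntegrableOn
      (fun u => c k i * c k i' * (f i u * f i' u)) (Ioc (grid s t n k) (grid s t n (k + 1))) :=
    fun k hk i i' => ((hf i i').mono_set (Ioc_subset_Icc_self.trans (Icc_subset_Icc
      (grid_mem hst (Finset.mem_range.1 hk).le).1
      (grid_mem hst (Nat.succ_le_of_lt (Finset.mem_range.1 hk))).2))).const_mul _
  rw [integral_finsetSum _ fun k hk => (integrable_indicator_iff measurableSet_Ioc).2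
    (integrable_finsetSum _ fun i _ => integrable_finsetSum _ fun i' _ => hi k hk i i')]
  refine Finset.sum_congr rfl fun k hk => ?_
  rw [integral_indicator measurableSet_Ioc, integral_finsetSum _ fun i _ =>
    integrable_finsetSum _ fun i' _ => hi k hk i i']
  refine Finset.sum_congr rfl fun i _ => ?_
  rw [integral_finsetSum _ fun i' _ => hi k hk i i']
  refine Finset.sum_congr rfl fun i' _ => ?_
  rw [intervalIntegral.integral_of_le (hmono (Nat.le_succ k))]

/-- The transition law is normal. -/
theorem Data.IsSolution.integral_cexp (hD : D.IsAdmissible) (hΦ : D.IsFundamental Φ)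
    (hW : IsBrownianVector P W) {s t : ℝ} (hs : 0 ≤ s) (hst : s ≤ t) (ht : t ≤ D.T)
    {x : Fin d → ℝ} {X : ℝ → Ω → Fin d → ℝ} (hX : D.IsSolution P W s x X) (θ : Fin d → ℝ) :
    ∫ ω, Complex.exp (Complex.I * (θ ⬝ᵥ X t ω : ℝ)) ∂P =
      Complex.exp (Complex.I * (θ ⬝ᵥ D.transMean Φ s t x : ℝ) -
        ((θ ⬝ᵥ (D.transCov Φ s t *ᵥ θ) : ℝ) : ℂ) / 2) := by
  have hs' : s ∈ Icc 0 D.T := ⟨hs, hst.trans ht⟩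
  have ht' : t ∈ Icc 0 D.T := ⟨hs.trans hst, ht⟩
  have hsub : Icc s t ⊆ Icc 0 D.T := Icc_subset_Icc hs ht
  set c : ℝ → Fin d → ℝ := fun u => θ ᵥ* flow Φ t u with hc
  -- `N n` is the Riemann–Stieltjes sum and `F n` below is its kernel, built with the same
  -- coefficients at the right ends.
  set N : ℕ → Ω → ℝ := fun n ω => ∑ k ∈ Finset.range (n + 1), ∑ i, c (grid s t n (k + 1)) i *
    (D.martPart s (fun t => X t ω) (grid s t n (k + 1)) i -
      D.martPart s (fun t => X t ω) (grid s t n k) i) with hN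
  set F : ℕ → Fin d' → ℝ → ℝ := fun n j u => ∑ k ∈ Finset.range (n + 1), ∑ i,
    c (grid s t n (k + 1)) i * ((Ioc s (grid s t n (k + 1))).indicator (fun u => D.σ u i j) u -
      (Ioc s (grid s t n k)).indicator (fun u => D.σ u i j) u) with hF
  have hmem : ∀ n, (F n, N n) ∈ wienerPairs hW := by
    intro n
    have hg : ∀ k ≤ n + 1, ∀ i, ((fun j => (Ioc s (grid s t n k)).indicator fun u => D.σ u i j),
        fun ω => D.martPart s (fun t => X t ω) (grid s t n k) i) ∈ wienerPairs hW := fun k hk i =>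
      hX.martPart_mem_wienerPairs hD hW hs (Icc_subset_Icc_right ht (grid_mem hst hk)) i
    have h := sum_mem (t := Finset.range (n + 1)) fun k hk => sum_mem (t := Finset.univ)
      fun i _ => (wienerPairs hW).smul_mem (c (grid s t n (k + 1)) i)
        (sub_mem (hg (k + 1) (Nat.succ_le_of_lt (Finset.mem_range.1 hk)) i)
          (hg k (Finset.mem_range.1 hk).le i))
    convert h using 1
    refine Prod.ext ?_ ?_
    · rw [Prod.fst_sum]
      ext j u
      simp only [hF, Finset.sum_apply, Prod.fst_sum, Prod.smul_fst, Prod.fst_sub, Pi.smul_apply,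
        Pi.sub_apply, smul_eq_mul]
    · rw [Prod.snd_sum]
      ext ω
      simp only [hN, Finset.sum_apply, Prod.snd_sum, Prod.smul_snd, Prod.snd_sub, Pi.smul_apply,
        Pi.sub_apply, smul_eq_mul]
  have hchar := fun n => integral_cexp_of_mem_wienerPairs hW (hmem n)
  have hvar : Tendsto (fun n => ∑ j, ∫ u, F n j u ^ 2) atTop
      (𝓝 (θ ⬝ᵥ (D.transCov Φ s t *ᵥ θ))) := by
    rw [hΦ.dotProduct_transCov hD hs' ht']
    have hcc : ∀ i, ContinuousOn (fun q : ℝ × ℝ × ℝ => c q.2.1 i)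
        (Icc s t ×ˢ Icc s t ×ˢ Icc s t) := fun i =>
      ((hΦ.continuousOn_vecMul_flow hD θ t i).mono hsub).comp (by fun_prop) fun q hq => hq.2.1
    refine tendsto_finsetSum _ fun j _ => ?_
    have l := tendsto_finsetSum Finset.univ fun i _ => tendsto_finsetSum Finset.univ fun i' _ =>
      tendsto_sum_integral_grid hst ((hcc i).mul (hcc i'))
        ((hD.integrableOn_σ_mul_σ i i' j).mono_set hsub)
    refine l.congr fun n => ?_
    simp only [hF]
    rw [integral_sq_sum_indicator_grid hst n (fun k => c (grid s t n (k + 1)))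
      fun i i' => (hD.integrableOn_σ_mul_σ i i' j).mono_set hsub]
    simp only [Finset.sum_comm (s := Finset.univ (α := Fin d)) (t := Finset.range (n + 1))]
    rfl
  have hlim : ∀ᵐ ω ∂P, Tendsto (fun n => N n ω) atTop
      (𝓝 (θ ⬝ᵥ X t ω - θ ⬝ᵥ D.transMean Φ s t x)) := by
    filter_upwards [hX.continuousOn, hX.initial] with ω h1 h2
    have h := tendsto_sum_flow_mul_martPart hD hΦ hs hst ht θ
      (h1.mono (Icc_subset_Icc_right ht))
    rw [hΦ.dotProduct_transMean hD hs' ht', ← sub_sub, ← h2]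
    exact h
  have hcexp : Continuous fun r : ℝ => Complex.exp (Complex.I * r) := by fun_prop
  have hleft : Tendsto (fun n => ∫ ω, Complex.exp (Complex.I * N n ω) ∂P) atTop
      (𝓝 (∫ ω, Complex.exp
        (Complex.I * ((θ ⬝ᵥ X t ω - θ ⬝ᵥ D.transMean Φ s t x : ℝ) : ℂ)) ∂P)) := by
    refine tendsto_integral_of_dominated_convergence (fun _ => 1) (fun n => ?_)
      (integrable_const 1) (fun n => ae_of_all _ fun ω => ?_) ?_
    · exact hcexp.comp_aestronglyMeasurable (hmem n).2.1.1
    · rw [Complex.norm_exp]; simp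
    · filter_upwards [hlim] with ω hω
      exact (hcexp.tendsto _).comp hω
  have hright := ((Complex.continuous_exp.comp (f := fun x : ℝ => -(x : ℂ) / 2)
    (by fun_prop)).tendsto _).comp hvar
  -- The same sequence of expectations has two limits: one from pathwise convergence, one from the
  -- normal law of each `N n`.
  have heq := tendsto_nhds_unique hleft (hright.congr fun n => (hchar n).symm)
  have e : ∀ ω, Complex.exp (Complex.I * (θ ⬝ᵥ X t ω : ℝ)) =
      Complex.exp (Complex.I * (θ ⬝ᵥ D.transMean Φ s t x : ℝ)) * Complex.exp
        (Complex.I * ((θ ⬝ᵥ X t ω - θ ⬝ᵥ D.transMean Φ s t x : ℝ) : ℂ)) := by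
    intro ω
    rw [← Complex.exp_add]
    congr 1
    push_cast
    ring
  simp only [e]
  rw [integral_const_mul, heq, Function.comp_apply, ← Complex.exp_add]
  congr 1
  ring

end Transition

/-! ### Matching with `L`, `μ` and `M`; closed form of `ρ` -/

section Identification

variable {d d' mS mT : ℕ} {D : Data d d' mS mT} {Φ : ℝ → Matrix (Fin d) (Fin d) ℝ}

theorem intervalIntegrable_mulVec {m n : Type*} [Fintype n] {g : ℝ → n → ℝ} {s t : ℝ}
    (hg : ∀ i, IntervalIntegrable (fun u => g u i) volume s t) (A : Matrix m n ℝ) (k : m) :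
    IntervalIntegrable (fun u => (A *ᵥ g u) k) volume s t := by
  simp only [mulVec, dotProduct]
  simpa only [Finset.sum_fn] using
    IntervalIntegrable.sum (f := fun i u => A k i * g u i) Finset.univ fun i _ => (hg i).const_mul _

theorem mulVec_integral {m n : Type*} [Fintype n] {g : ℝ → n → ℝ} {s t : ℝ}
    (hg : ∀ i, IntervalIntegrable (fun u => g u i) volume s t) (A : Matrix m n ℝ) :
    A *ᵥ (fun i => ∫ u in s..t, g u i) = fun k => ∫ u in s..t, (A *ᵥ g u) k := by
  ext k
  simp only [mulVec, dotProduct]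
  rw [intervalIntegral.integral_finsetSum fun i _ => (hg i).const_mul _]
  exact Finset.sum_congr rfl fun i _ => (intervalIntegral.integral_const_mul _ _).symm

theorem intervalIntegrable_mul_mul {k m n l : Type*} [Fintype m] [Fintype n]
    {F : ℝ → Matrix m n ℝ} {s t : ℝ}
    (hF : ∀ i j, IntervalIntegrable (fun u => F u i j) volume s t) (A : Matrix k m ℝ)
    (B : Matrix n l ℝ) (p : k) (q : l) :
    IntervalIntegrable (fun u => (A * F u * B) p q) volume s t := by
  have h : ∀ i : m, IntervalIntegrable (fun u => (F u *ᵥ fun j => B j q) i) volume s t := fun i => by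
    simp only [mulVec, dotProduct]
    simpa only [Finset.sum_fn] using
      IntervalIntegrable.sum (f := fun j u => F u i j * B j q) Finset.univ
        fun j _ => (hF i j).mul_const _
  have h2 := intervalIntegrable_mulVec h A p
  refine h2.congr fun u _ => ?_
  simp only [Matrix.mul_assoc]
  rfl

theorem Data.IsFundamental.intervalIntegrable_flow_mul_a (hD : D.IsAdmissible)
    (hΦ : D.IsFundamental Φ) {s t : ℝ} (hs : s ∈ Icc 0 D.T) (ht : t ∈ Icc 0 D.T) (i j : Fin d) :
    IntervalIntegrable (fun u => (flow Φ t u * D.a u * (flow Φ t u)ᵀ) i j) volume s t :=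
  IntegrableOn.intervalIntegrable_of_mem (hΦ.integrableOn_flow_mul_a hD t i j) hs ht

theorem Data.IsFundamental.intervalIntegrable_flow_mulVec_β (hD : D.IsAdmissible)
    (hΦ : D.IsFundamental Φ) {s t : ℝ} (hs : s ∈ Icc 0 D.T) (ht : t ∈ Icc 0 D.T) (i : Fin d) :
    IntervalIntegrable (fun u => (flow Φ t u *ᵥ D.β u) i) volume s t := by
  refine IntegrableOn.intervalIntegrable_of_mem ?_ hs ht
  simp only [mulVec, dotProduct]
  exact integrable_finsetSum _ fun j _ => (hD.integrable_β j).continuousOn_mul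
    (hΦ.continuousOn_flow_entry hD t i j) isCompact_Icc

/-- The observation matrix of the pair of observations as seen from time `S`. -/
noncomputable def Data.obsMatrix (D : Data d d' mS mT) (Φ : ℝ → Matrix (Fin d) (Fin d) ℝ) :
    Matrix (Fin mS ⊕ Fin mT) (Fin d) ℝ :=
  fromRows D.LS (D.Llate Φ D.S)

theorem Data.IsAdmissible.S_mem (hD : D.IsAdmissible) : D.S ∈ Icc 0 D.T :=
  ⟨hD.S_pos.le, hD.S_lt_T.le⟩

theorem Data.IsAdmissible.T_mem (hD : D.IsAdmissible) : D.T ∈ Icc 0 D.T :=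
  ⟨hD.T_pos.le, le_rfl⟩

/-- Up to `S` both block rows factor through the state at `S`, because `Φ(T,τ) = Φ(T,S)Φ(S,τ)`. -/
theorem Data.IsFundamental.Learly_of_le (hD : D.IsAdmissible) (hΦ : D.IsFundamental Φ) {τ : ℝ}
    (hτ : τ ∈ Icc 0 D.S) : D.Learly Φ τ = D.obsMatrix Φ * flow Φ D.S τ := by
  rw [Learly, obsMatrix, fromRows_mul, indicator_of_mem hτ, Llate, Matrix.mul_assoc,
    hΦ.flow_mul_flow hD hD.S_mem]

theorem Data.Learly_of_lt (D : Data d d' mS mT) (Φ : ℝ → Matrix (Fin d) (Fin d) ℝ) {τ : ℝ}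
    (hτ : D.S < τ) : D.Learly Φ τ = fromRows 0 (D.Llate Φ τ) := by
  rw [Learly, indicator_of_notMem fun h => hτ.not_ge h.2, Llate]

theorem Data.Llate_mul_a_mul (D : Data d d' mS mT) (Φ : ℝ → Matrix (Fin d) (Fin d) ℝ) (τ : ℝ) :
    D.Llate Φ τ * D.a τ * (D.Llate Φ τ)ᵀ =
      D.LT * (flow Φ D.T τ * D.a τ * (flow Φ D.T τ)ᵀ) * D.LTᵀ := by
  simp only [Llate, transpose_mul, Matrix.mul_assoc]

theorem Data.IsFundamental.Learly_mul_a_mul_of_le (hD : D.IsAdmissible) (hΦ : D.IsFundamental Φ)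
    {τ : ℝ} (hτ : τ ∈ Icc 0 D.S) : D.Learly Φ τ * D.a τ * (D.Learly Φ τ)ᵀ =
      D.obsMatrix Φ * (flow Φ D.S τ * D.a τ * (flow Φ D.S τ)ᵀ) * (D.obsMatrix Φ)ᵀ := by
  simp only [hΦ.Learly_of_le hD hτ, transpose_mul, Matrix.mul_assoc]

theorem Data.Learly_mul_a_mul_of_lt (D : Data d d' mS mT) (Φ : ℝ → Matrix (Fin d) (Fin d) ℝ)
    {τ : ℝ} (hτ : D.S < τ) : D.Learly Φ τ * D.a τ * (D.Learly Φ τ)ᵀ =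
      fromBlocks 0 0 0 (D.Llate Φ τ * D.a τ * (D.Llate Φ τ)ᵀ) := by
  rw [D.Learly_of_lt Φ hτ, fromRows_mul, transpose_fromRows, fromRows_mul_fromCols]
  simp

theorem Data.IsFundamental.MdagLate_eq (hD : D.IsAdmissible) (hΦ : D.IsFundamental Φ) {t : ℝ}
    (ht : t ∈ Icc 0 D.T) : D.MdagLate Φ t = D.covT + D.LT * D.transCov Φ t D.T * D.LTᵀ := by
  rw [MdagLate, add_comm, transCov,
    mul_matIntegral_mul (hΦ.intervalIntegrable_flow_mul_a hD ht hD.T_mem)]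
  simp only [D.Llate_mul_a_mul]

theorem Data.IsFundamental.obs_sub_muLate (hD : D.IsAdmissible) (hΦ : D.IsFundamental Φ) {t : ℝ}
    (ht : t ∈ Icc 0 D.T) (x : Fin d → ℝ) :
    D.vT - D.LT *ᵥ D.transMean Φ t D.T x = D.vT - D.muLate Φ t - D.Llate Φ t *ᵥ x := by
  have h : D.muLate Φ t = D.LT *ᵥ fun i => ∫ u in t..D.T, (flow Φ D.T u *ᵥ D.β u) i := by
    rw [mulVec_integral (hΦ.intervalIntegrable_flow_mulVec_β hD ht hD.T_mem)]
    simp only [mulVec_mulVec]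
    rfl
  rw [h, transMean, mulVec_add, mulVec_mulVec, Llate]
  abel

/-- The integral is split at `S`. Beyond `S` only the lower right block survives, and together with
`covT` it is the late matrix at `S`; before `S` the factorisation through the state at `S` applies.
-/
theorem Data.IsFundamental.MdagEarly_eq (hD : D.IsAdmissible) (hΦ : D.IsFundamental Φ) {t : ℝ}
    (ht : t ∈ Icc 0 D.S) : D.MdagEarly Φ t = fromBlocks D.covS 0 0 (D.MdagLate Φ D.S) +
      D.obsMatrix Φ * D.transCov Φ t D.S * (D.obsMatrix Φ)ᵀ := by
  have ht' : t ∈ Icc 0 D.T := ⟨ht.1, ht.2.trans hD.S_lt_T.le⟩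
  have hi := hΦ.intervalIntegrable_flow_mul_a hD ht' hD.S_mem
  have hi2 := hΦ.intervalIntegrable_flow_mul_a hD hD.S_mem hD.T_mem
  have e1 : ∀ τ ∈ uIoc t D.S, D.Learly Φ τ * D.a τ * (D.Learly Φ τ)ᵀ =
      D.obsMatrix Φ * (flow Φ D.S τ * D.a τ * (flow Φ D.S τ)ᵀ) * (D.obsMatrix Φ)ᵀ :=
    fun τ hτ => by
      rw [uIoc_of_le ht.2] at hτ
      exact hΦ.Learly_mul_a_mul_of_le hD ⟨ht.1.trans hτ.1.le, hτ.2⟩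
  have e2 : ∀ τ ∈ uIoc D.S D.T, D.Learly Φ τ * D.a τ * (D.Learly Φ τ)ᵀ =
      fromBlocks 0 0 0 (D.Llate Φ τ * D.a τ * (D.Llate Φ τ)ᵀ) := fun τ hτ => by
    rw [uIoc_of_le hD.S_lt_T.le] at hτ
    exact D.Learly_mul_a_mul_of_lt Φ hτ.1
  have i1 : ∀ p q, IntervalIntegrable
      (fun τ => (D.Learly Φ τ * D.a τ * (D.Learly Φ τ)ᵀ) p q) volume t D.S := fun p q =>
    (intervalIntegrable_mul_mul hi (D.obsMatrix Φ) (D.obsMatrix Φ)ᵀ p q).congr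
      fun τ hτ => by simp only [e1 τ hτ]
  have i2 : ∀ p q, IntervalIntegrable
      (fun τ => (D.Learly Φ τ * D.a τ * (D.Learly Φ τ)ᵀ) p q) volume D.S D.T := fun p q => by
    have h : IntervalIntegrable (fun τ => (fromBlocks (0 : Matrix (Fin mS) (Fin mS) ℝ) 0 0
        (D.Llate Φ τ * D.a τ * (D.Llate Φ τ)ᵀ)) p q) volume D.S D.T := by
      simp only [D.Llate_mul_a_mul]
      rcases p with p | p <;> rcases q with q | q
      · simp
      · simp
      · simp
      · exact intervalIntegrable_mul_mul hi2 D.LT D.LTᵀ p q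
    exact h.congr
      fun τ hτ => by simp only [e2 τ hτ]
  rw [transCov, mul_matIntegral_mul hi]
  ext p q
  rw [MdagEarly, UpsEarly, Matrix.add_apply, Matrix.add_apply, matIntegral, of_apply,
    ← intervalIntegral.integral_add_adjacent_intervals (i1 p q) (i2 p q),
    intervalIntegral.integral_congr_ae (ae_of_all _ fun τ hτ => by rw [e1 τ hτ]),
    intervalIntegral.integral_congr_ae (a := D.S) (ae_of_all _ fun τ hτ => by rw [e2 τ hτ])]
  rcases p with p | p <;> rcases q with q | q <;> simp [MdagLate, matIntegral] <;> ring

theorem Data.IsFundamental.obs_sub_muEarly (hD : D.IsAdmissible) (hΦ : D.IsFundamental Φ) {t : ℝ}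
    (ht : t ∈ Icc 0 D.S) (x : Fin d → ℝ) :
    Sum.elim D.vS (D.vT - D.muLate Φ D.S) - D.obsMatrix Φ *ᵥ D.transMean Φ t D.S x =
      D.obsEarly - D.muEarly Φ t - D.Learly Φ t *ᵥ x := by
  have ht' : t ∈ Icc 0 D.T := ⟨ht.1, ht.2.trans hD.S_lt_T.le⟩
  have hi := hΦ.intervalIntegrable_flow_mulVec_β hD ht' hD.S_mem
  have hi2 := hΦ.intervalIntegrable_flow_mulVec_β hD hD.S_mem hD.T_mem
  have e1 : ∀ τ ∈ uIoc t D.S, D.Learly Φ τ *ᵥ D.β τ = D.obsMatrix Φ *ᵥ (flow Φ D.S τ *ᵥ D.β τ) :=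
    fun τ hτ => by
      rw [uIoc_of_le ht.2] at hτ
      rw [hΦ.Learly_of_le hD ⟨ht.1.trans hτ.1.le, hτ.2⟩, mulVec_mulVec]
  have e2 : ∀ τ ∈ uIoc D.S D.T, D.Learly Φ τ *ᵥ D.β τ =
      Sum.elim (0 : Fin mS → ℝ) (D.Llate Φ τ *ᵥ D.β τ) :=
    fun τ hτ => by
      rw [uIoc_of_le hD.S_lt_T.le] at hτ
      rw [D.Learly_of_lt Φ hτ.1, fromRows_mulVec, zero_mulVec]
  have i1 : ∀ p, IntervalIntegrable (fun τ => (D.Learly Φ τ *ᵥ D.β τ) p) volume t D.S := fun p =>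
    (intervalIntegrable_mulVec hi (D.obsMatrix Φ) p).congr
      fun τ hτ => by simp only [e1 τ hτ]
  have i2 : ∀ p, IntervalIntegrable (fun τ => (D.Learly Φ τ *ᵥ D.β τ) p) volume D.S D.T :=
      fun p => by
    have h : IntervalIntegrable (fun τ => (Sum.elim (0 : Fin mS → ℝ)
        (D.Llate Φ τ *ᵥ D.β τ)) p) volume D.S D.T := by
      simp only [Llate, ← mulVec_mulVec]
      rcases p with p | p
      · simp
      · exact intervalIntegrable_mulVec hi2 D.LT p
    exact h.congr
      fun τ hτ => by simp only [e2 τ hτ]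
  have hmu : D.muEarly Φ t = Sum.elim (0 : Fin mS → ℝ) (D.muLate Φ D.S) +
      D.obsMatrix Φ *ᵥ fun i => ∫ u in t..D.S, (flow Φ D.S u *ᵥ D.β u) i := by
    rw [mulVec_integral hi]
    ext p
    rw [muEarly, Pi.add_apply, ← intervalIntegral.integral_add_adjacent_intervals (i1 p) (i2 p),
      intervalIntegral.integral_congr_ae (ae_of_all _ fun τ hτ => by rw [e1 τ hτ]),
      intervalIntegral.integral_congr_ae (a := D.S) (ae_of_all _ fun τ hτ => by rw [e2 τ hτ]),
      add_comm]
    congr 1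
    rcases p with p | p <;> simp [muLate]
  have hs : Sum.elim D.vS (D.vT - D.muLate Φ D.S) =
      D.obsEarly - Sum.elim (0 : Fin mS → ℝ) (D.muLate Φ D.S) := by
    ext (p | p) <;> simp [obsEarly]
  rw [hmu, hs, transMean, mulVec_add, mulVec_mulVec, ← hΦ.Learly_of_le hD ht]
  abel

/-- At `t = T` the integral is empty, and an invertible positive semidefinite matrix is positive
definite. -/
theorem Data.MExists.posDef_covT (hD : D.IsAdmissible) (hM : D.MExists Φ) : D.covT.PosDef := by
  have h := hM.2 D.T ⟨hD.S_lt_T, le_rfl⟩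
  have e : D.MdagLate Φ D.T = D.covT := by
    ext i j
    simp [MdagLate, matIntegral]
  rw [e] at h
  exact hD.covT_posSemidef.posDef_iff_isUnit.2 h

/-- The assumption on the late matrix covers only `t > S`, but the inner integral of `ρ` needs it at
`S` itself; positive definiteness of `covT` supplies this. -/
theorem Data.MExists.posDef_MdagLate (hD : D.IsAdmissible) (hΦ : D.IsFundamental Φ)
    (hM : D.MExists Φ) {t : ℝ} (ht : t ∈ Icc 0 D.T) : (D.MdagLate Φ t).PosDef := by
  rw [hΦ.MdagLate_eq hD ht]
  refine (hM.posDef_covT hD).add_posSemidef ?_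
  simpa only [conjTranspose_eq_transpose_of_trivial] using
    (hΦ.posSemidef_transCov hD ht.1 ht.2 le_rfl).mul_mul_conjTranspose_same D.LT

/-- At `t = S` the early matrix is block diagonal with `covS` as a block, so `det covS` divides a
unit. -/
theorem Data.MExists.posDef_covS (hD : D.IsAdmissible) (hΦ : D.IsFundamental Φ)
    (hM : D.MExists Φ) : D.covS.PosDef := by
  have h := hM.1 D.S ⟨hD.S_pos.le, le_rfl⟩
  have e : D.transCov Φ D.S D.S = 0 := by
    ext i j
    simp [transCov, matIntegral]
  rw [hΦ.MdagEarly_eq hD ⟨hD.S_pos.le, le_rfl⟩, e, Matrix.mul_zero, Matrix.zero_mul, add_zero,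
    isUnit_iff_isUnit_det, det_fromBlocks_zero₂₁] at h
  exact hD.covS_posSemidef.posDef_iff_isUnit.2
    ((isUnit_iff_isUnit_det _).2 (isUnit_of_mul_isUnit_left h))

theorem Data.MExists.posDef_fromBlocks (hD : D.IsAdmissible) (hΦ : D.IsFundamental Φ)
    (hM : D.MExists Φ) : (fromBlocks D.covS 0 0 (D.MdagLate Φ D.S)).PosDef :=
  TwoCond.posDef_fromBlocks (hM.posDef_covS hD hΦ) (hM.posDef_MdagLate hD hΦ hD.S_mem)

theorem Data.MExists.posDef_MdagEarly (hD : D.IsAdmissible) (hΦ : D.IsFundamental Φ)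
    (hM : D.MExists Φ) {t : ℝ} (ht : t ∈ Icc 0 D.S) : (D.MdagEarly Φ t).PosDef := by
  rw [hΦ.MdagEarly_eq hD ht]
  refine (hM.posDef_fromBlocks hD hΦ).add_posSemidef ?_
  simpa only [conjTranspose_eq_transpose_of_trivial] using
    (hΦ.posSemidef_transCov hD ht.1 ht.2 hD.S_lt_T.le).mul_mul_conjTranspose_same (D.obsMatrix Φ)

variable {Ω : Type*} [MeasurableSpace Ω] {P : Measure Ω} [IsProbabilityMeasure P]
  {W : Fin d' → ℝ≥0 → Ω → ℝ} {X : ℝ → (Fin d → ℝ) → ℝ → Ω → Fin d → ℝ}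

/-- The integral of a normal density, composed with an affine map, against the transition law. -/
theorem Data.IsSolution.integral_gaussDensity {ι : Type*} [Fintype ι] [DecidableEq ι]
    (hD : D.IsAdmissible) (hΦ : D.IsFundamental Φ)
    (hW : IsBrownianVector P W) {s t : ℝ} (hs : 0 ≤ s) (hst : s ≤ t) (ht : t ≤ D.T)
    {x : Fin d → ℝ} {Y : ℝ → Ω → Fin d → ℝ} (hY : D.IsSolution P W s x Y) {Q : Matrix ι ι ℝ}
    (hQ : Q.PosDef) (L : Matrix ι (Fin d) ℝ) (v : ι → ℝ) :
    ∫ ξ, gaussDensity (v - L *ᵥ ξ) Q ∂(P.map (Y t)) =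
      gaussDensity (v - L *ᵥ D.transMean Φ s t x) (Q + L * D.transCov Φ s t * Lᵀ) := by
  have hm := hY.measurable t ⟨hst, ht⟩
  have hc : Continuous fun ξ : Fin d → ℝ => gaussDensity (v - L *ᵥ ξ) Q :=
    (continuous_gaussDensity Q).comp
      (continuous_const.sub (continuous_const.matrix_mulVec continuous_id))
  rw [integral_map hm.aemeasurable hc.aestronglyMeasurable]
  exact integral_gaussDensity_of_charFun hm.aemeasurable (hΦ.posSemidef_transCov hD hs hst ht)
    (hY.integral_cexp hD hΦ hW hs hst ht) hQ L v

theorem integral_normalDensity_terminal (hD : D.IsAdmissible) (hΦ : D.IsFundamental Φ)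
    (hM : D.MExists Φ) (hW : IsBrownianVector P W)
    (hX : ∀ s ∈ Icc 0 D.T, ∀ x, D.IsSolution P W s x (X s x)) {t : ℝ} (ht : t ∈ Icc 0 D.T)
    (x : Fin d → ℝ) :
    ∫ ξ, normalDensity (D.vT - D.LT *ᵥ ξ) D.covT ∂(P.map (X t x D.T)) =
      gaussDensity (D.vT - D.muLate Φ t - D.Llate Φ t *ᵥ x) (D.MdagLate Φ t) := by
  simp only [normalDensity_eq_gaussDensity]
  rw [(hX t ht x).integral_gaussDensity hD hΦ hW ht.1 ht.2 le_rfl (hM.posDef_covT hD),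
    ← hΦ.MdagLate_eq hD ht, hΦ.obs_sub_muLate hD ht]

theorem rho_of_lt (hD : D.IsAdmissible) (hΦ : D.IsFundamental Φ)
    (hM : D.MExists Φ) (hW : IsBrownianVector P W)
    (hX : ∀ s ∈ Icc 0 D.T, ∀ x, D.IsSolution P W s x (X s x)) {t : ℝ} (ht : t ∈ Ioc D.S D.T)
    (x : Fin d → ℝ) : D.rho P X t x =
      gaussDensity (D.vT - D.muLate Φ t - D.Llate Φ t *ᵥ x) (D.MdagLate Φ t) := by
  rw [Data.rho, if_neg ht.1.not_ge]
  exact integral_normalDensity_terminal hD hΦ hM hW hX ⟨hD.S_pos.le.trans ht.1.le, ht.2⟩ x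

/-- The inner integral is the terminal formula at `S`; multiplied by the density of the first
observation it is a normal density of the stacked vector, affine in `ξS`, and is integrated against
the law at `S`. -/
theorem rho_of_le (hD : D.IsAdmissible) (hΦ : D.IsFundamental Φ)
    (hM : D.MExists Φ) (hW : IsBrownianVector P W)
    (hX : ∀ s ∈ Icc 0 D.T, ∀ x, D.IsSolution P W s x (X s x)) {t : ℝ} (ht : t ∈ Icc 0 D.S)
    (x : Fin d → ℝ) : D.rho P X t x =
      gaussDensity (D.obsEarly - D.muEarly Φ t - D.Learly Φ t *ᵥ x) (D.MdagEarly Φ t) := by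
  have e : ∀ ξ : Fin d → ℝ, Sum.elim (D.vS - D.LS *ᵥ ξ)
      (D.vT - D.muLate Φ D.S - D.Llate Φ D.S *ᵥ ξ) =
      Sum.elim D.vS (D.vT - D.muLate Φ D.S) - D.obsMatrix Φ *ᵥ ξ := fun ξ => by
    rw [Data.obsMatrix, fromRows_mulVec]
    ext (p | p) <;> simp
  rw [Data.rho, if_pos ht.2]
  simp only [integral_normalDensity_terminal hD hΦ hM hW hX hD.S_mem]
  simp only [normalDensity_eq_gaussDensity, gaussDensity_mul_gaussDensity (hM.posDef_covS hD hΦ)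
      (hM.posDef_MdagLate hD hΦ hD.S_mem), e]
  rw [(hX t ⟨ht.1, ht.2.trans hD.S_lt_T.le⟩ x).integral_gaussDensity hD hΦ hW ht.1 ht.2
    hD.S_lt_T.le (hM.posDef_fromBlocks hD hΦ), ← hΦ.MdagEarly_eq hD ht, hΦ.obs_sub_muEarly hD ht]

end Identification

end TwoCond

/-! ### Derivatives of `log ρ` -/

theorem mainTheorem1 {d d' mS mT : ℕ} (D : TwoCond.Data d d' mS mT) (hD : D.IsAdmissible)
    {Ω : Type*} [MeasurableSpace Ω] (P : Measure Ω) [IsProbabilityMeasure P]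
    (W : Fin d' → ℝ≥0 → Ω → ℝ) (hW : TwoCond.IsBrownianVector P W)
    (X : ℝ → (Fin d → ℝ) → ℝ → Ω → Fin d → ℝ)
    (hX : ∀ s ∈ Icc 0 D.T, ∀ x, D.IsSolution P W s x (X s x))
    (Φ : ℝ → Matrix (Fin d) (Fin d) ℝ) (hΦ : D.IsFundamental Φ)
    (hM : D.MExists Φ) :
    (∀ t ∈ Icc 0 D.T, (∀ x, 0 < D.rho P X t x) ∧
      ContDiff ℝ 2 (fun x => Real.log (D.rho P X t x))) ∧
    (∀ t ∈ Icc 0 D.S, ∀ x,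
      D.H P X t x = (D.Learly Φ t)ᵀ * D.Mearly Φ t * D.Learly Φ t ∧
      D.r P X t x = ((D.Learly Φ t)ᵀ * D.Mearly Φ t) *ᵥ
        (D.obsEarly - D.muEarly Φ t - D.Learly Φ t *ᵥ x)) ∧
    (∀ t ∈ Ioc D.S D.T, ∀ x,
      D.H P X t x = (D.Llate Φ t)ᵀ * D.Mlate Φ t * D.Llate Φ t ∧
      D.r P X t x = ((D.Llate Φ t)ᵀ * D.Mlate Φ t) *ᵥ
        (D.vT - D.muLate Φ t - D.Llate Φ t *ᵥ x)) := by
  have hearly := fun t (ht : t ∈ Icc 0 D.S) => TwoCond.rho_of_le hD hΦ hM hW hX ht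
  have hlate := fun t (ht : t ∈ Ioc D.S D.T) => TwoCond.rho_of_lt hD hΦ hM hW hX ht
  have hQe := fun t (ht : t ∈ Icc 0 D.S) => hM.posDef_MdagEarly hD hΦ ht
  have hQl := fun t (ht : t ∈ Ioc D.S D.T) =>
    hM.posDef_MdagLate hD hΦ ⟨hD.S_pos.le.trans ht.1.le, ht.2⟩
  refine ⟨fun t ht => ?_, fun t ht x => ?_, fun t ht x => ?_⟩
  · rcases le_or_gt t D.S with h | h
    · simp only [hearly t ⟨ht.1, h⟩]
      exact ⟨fun x => TwoCond.gaussDensity_pos (hQe t ⟨ht.1, h⟩) _,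
        TwoCond.contDiff_log_gaussDensity (hQe t ⟨ht.1, h⟩) _ _⟩
    · simp only [hlate t ⟨h, ht.2⟩]
      exact ⟨fun x => TwoCond.gaussDensity_pos (hQl t ⟨h, ht.2⟩) _,
        TwoCond.contDiff_log_gaussDensity (hQl t ⟨h, ht.2⟩) _ _⟩
  · simp only [TwoCond.Data.H, TwoCond.Data.r, hearly t ht,
      TwoCond.hess_log_gaussDensity (hQe t ht), TwoCond.grad_log_gaussDensity (hQe t ht), neg_neg]
    exact ⟨rfl, rfl⟩
  · simp only [TwoCond.Data.H, TwoCond.Data.r, hlate t ht,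
      TwoCond.hess_log_gaussDensity (hQl t ht), TwoCond.grad_log_gaussDensity (hQl t ht), neg_neg]
    exact ⟨rfl, rfl⟩
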